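/- A tessellation of the Euclidean plane is a locally finite family of closed topological disks (tiles) that cover the plane and meet one another only along their boundary curves. A vertex is a point at which at least three tiles meet; every tile has only finitely many vertices. An edge is a connected component of the set of points at which exactly two tiles meet. The imbalance of a tile with $n$ vertices, at which $q_1,\dots,q_n$ tiles meet, is $$\sum_{i=1}^n \frac{2\pi}{q_i}-(n-2)\pi .$$ For a point $x$ of the plane and $r>0$, let $C_x(r)$ be the configuration of all tiles that meet the closed disk of radius $r$ centered at $x$. The tessellation is reasonably round if there are constants $c_1>0$, $c_2$ and $R_0$ such that for every $R\ge R_0$ and every point $x$, the configuration $C_x(R)$ has at least $c_1R^2$ tiles, and at most $c_2R$ edges lie on the boundary of the union of the tiles of $C_x(R)$. Theorem. In every reasonably round tessellation of the Euclidean plane, the average imbalance of the tiles of $C_x(r)$, $$\frac{1}{|C_x(r)|}\sum_{t\in C_x(r)}\mathrm{imbalance}(t),$$ tends to $0$ as $r\to\infty$, uniformly in the center $x$. -/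

import Mathlib

/-- The Euclidean plane. -/
abbrev Plane : Type := EuclideanSpace ℝ (Fin 2)

/-- The closed unit disk, the model of a closed topological disk. -/
abbrev ClosedDisk : Type := Metric.closedBall (0 : Plane) 1

/-- The number of members of the family `tile` that contain the point `p`. -/
noncomputable def valenceOf {ι : Type*} (tile : ι → Set Plane) (p : Plane) : ℕ :=
  {i | p ∈ tile i}.ncard

/-- A tessellation of the Euclidean plane: a locally finite covering of the plane by closed
topological disks (homeomorphic images of the closed unit disk) which meet one another only along
their boundary curves, each tile having only finitely many vertices. A vertex of the tessellation
is a point at which at least three tiles meet. -/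
structure Tessellation (ι : Type*) where
  /-- A parametrization of each tile by the closed unit disk. -/
  param : ι → ClosedDisk → Plane
  continuous_param : ∀ i, Continuous (param i)
  injective_param : ∀ i, Function.Injective (param i)
  /-- There are no gaps. -/
  covers : (⋃ i, Set.range (param i)) = Set.univ
  /-- There are no overlaps: a point of a tile that lies in another tile as well is on the boundary
  curve of the tile, the image of the unit circle. -/
  no_overlap : ∀ i j, i ≠ j → ∀ x : ClosedDisk,
    param i x ∈ Set.range (param j) → ‖(x : Plane)‖ = 1
  locallyFinite : LocallyFinite fun i => Set.range (param i)
  finite_vertices : ∀ i,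
    {p ∈ Set.range (param i) | 3 ≤ valenceOf (fun j => Set.range (param j)) p}.Finite

namespace Tessellation

variable {ι : Type*} (T : Tessellation ι)

/-- The tiles, as subsets of the plane. -/
def tile (i : ι) : Set Plane := Set.range (T.param i)

/-- The number of tiles meeting at the point `p`. -/
noncomputable def valence (p : Plane) : ℕ := valenceOf T.tile p

/-- The vertices of the tile `i`: its points at which at least three tiles meet. -/
def vertices (i : ι) : Set Plane := {p ∈ T.tile i | 3 ≤ T.valence p}

/-- The edges of the tessellation, as open arcs: the connected components of the set of points at
which exactly two tiles meet. -/
def edges : Set (Set Plane) :=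
  {e | ∃ p, T.valence p = 2 ∧ e = connectedComponentIn {q | T.valence q = 2} p}

/-- The imbalance of a tile with `n` vertices, at which `q₁, …, qₙ` tiles meet:
the sum of the `2 π / qₖ`, minus `(n - 2) π`. -/
noncomputable def imbalance (i : ι) : ℝ :=
  (∑ᶠ p ∈ T.vertices i, 2 * Real.pi / (T.valence p : ℝ))
    - (((T.vertices i).ncard : ℝ) - 2) * Real.pi

/-- The configuration of the tiles that meet the disk with center `x` and radius `r`. -/
def configuration (x : Plane) (r : ℝ) : Set ι :=
  {i | (T.tile i ∩ Metric.closedBall x r).Nonempty}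

/-- The edges lying on the boundary of the region covered by the configuration `C`. -/
def boundaryEdges (C : Set ι) : Set (Set Plane) :=
  {e ∈ T.edges | e ⊆ frontier (⋃ i ∈ C, T.tile i)}

/-- The tessellation is reasonably round: there are constants `c₁ > 0` and `c₂` such that every
sufficiently large disk, of radius `R` say, meets at least `c₁ R ^ 2` tiles, and the boundary of
the configuration of these tiles has at most `c₂ R` edges. -/
def ReasonablyRound : Prop :=
  ∃ c₁ c₂ R₀ : ℝ, 0 < c₁ ∧ ∀ R : ℝ, R₀ ≤ R → ∀ x : Plane,
    c₁ * R ^ 2 ≤ ((T.configuration x R).ncard : ℝ) ∧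
    (T.boundaryEdges (T.configuration x R)).Finite ∧
    ((T.boundaryEdges (T.configuration x R)).ncard : ℝ) ≤ c₂ * R

/-- The average imbalance of the tiles that meet the disk with center `x` and radius `r`. -/
noncomputable def averageImbalance (x : Plane) (r : ℝ) : ℝ :=
  (∑ᶠ i ∈ T.configuration x r, T.imbalance i) / ((T.configuration x r).ncard : ℝ)

/-- Every point lies in only finitely many tiles, so that the valence is an honest count. -/
theorem finite_tiles_at (p : Plane) : {i | p ∈ T.tile i}.Finite :=
  T.locallyFinite.point_finite p

/-- Every tile has only finitely many vertices. -/
theorem vertices_finite (i : ι) : (T.vertices i).Finite :=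
  T.finite_vertices i

/-- Every disk meets only finitely many tiles, so that the average is an honest one. -/
theorem configuration_finite (x : Plane) (r : ℝ) : (T.configuration x r).Finite :=
  T.locallyFinite.finite_nonempty_inter_compact (isCompact_closedBall x r)

/-- A disk of nonnegative radius meets some tile. -/
theorem configuration_nonempty (x : Plane) {r : ℝ} (hr : 0 ≤ r) :
    (T.configuration x r).Nonempty := by
  have hx : x ∈ ⋃ i, Set.range (T.param i) := T.covers ▸ Set.mem_univ x
  obtain ⟨i, hi⟩ := Set.mem_iUnion.1 hx
  exact ⟨i, x, hi, Metric.mem_closedBall_self hr⟩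

end Tessellation

/-! ### Circles and embedded disks in the plane -/

open scoped Topology

/-! Let a configuration have `F` tiles. Summing imbalances over it and exchanging the sums, a vertex
all of whose tiles belong to the configuration contributes exactly `2π` to the angle sum, and any
other vertex at most `2π`. The vertex counts of the tiles add up to twice the number of inner edges
plus the number of outer edges. Up to a multiple of the number of outer edges, the total is
therefore `2π (V - E + F)`, and Euler's formula should make it bounded. Dividing by `F ≥ c₁ r ^ 2`
while there are at most `c₂ r` boundary edges gives the limit, with a bound independent of the
center.

A configuration may have holes, so the exact Euler formula is replaced by two inequalities, proved
by linear algebra modulo two. `ncard_innerEdges_le` bounds edges from above: a labelling of edges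
with zero sum at each vertex is the difference of a labelling of tiles (`exists_potential`), because
such labellings exist locally and the obstruction to gluing them is a double covering of the simply
connected plane. `ncard_add_ncard_innerVertices_le` bounds edges from below: the edge-tile and
edge-vertex incidence matrices have orthogonal column spaces, and their kernels are small by
connectedness.

Both rest on the local combinatorics: an edge has two tiles and two ends (`exists_tiles_of_edge`,
`exists_ends_of_edge`), and at a vertex of a tile exactly two of its edges end
(`exists_edges_of_vertex`). For tiles that are mere topological disks this needs
`notMem_interior_range_of_norm_eq_one`, which makes every point of a boundary curve a point of a
second tile, and the fact that a tile has at least two vertices (`exists_vertex_ne`). -/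

theorem isConnected_unit_sphere : IsConnected (Metric.sphere (0 : Plane) 1) :=
  isConnected_sphere (by rw [← Module.finrank_eq_rank ℝ Plane]; simp) 0 zero_le_one

/-- A continuous real function on the unit circle takes the same value at some pair of antipodal
points, so it is not injective. -/
theorem not_injective_of_continuous_sphere_real {f : Metric.sphere (0 : Plane) 1 → ℝ}
    (hf : Continuous f) : ¬ Function.Injective f := by
  intro hinj
  have : PreconnectedSpace (Metric.sphere (0 : Plane) 1) :=
    isPreconnected_iff_preconnectedSpace.mp isConnected_unit_sphere.isPreconnected
  obtain ⟨x₀, hx₀⟩ := isConnected_unit_sphere.nonempty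
  let a : Metric.sphere (0 : Plane) 1 := ⟨x₀, hx₀⟩
  let g : Metric.sphere (0 : Plane) 1 → ℝ := fun x => f x - f (-x)
  have hg : Continuous g := hf.sub (hf.comp continuous_neg)
  have hneg : g (-a) = - g a := by simp [g]
  have hz : ∃ x, g x = 0 := by
    rcases le_total 0 (g a) with h | h
    · exact mem_range_of_exists_le_of_exists_ge hg ⟨-a, by rw [hneg]; linarith⟩ ⟨a, h⟩
    · exact mem_range_of_exists_le_of_exists_ge hg ⟨a, h⟩ ⟨-a, by rw [hneg]; linarith⟩
  obtain ⟨x, hx⟩ := hz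
  have : x = -x := hinj (sub_eq_zero.mp hx)
  have h1 : (x : Plane) = -(x : Plane) := by
    conv_lhs => rw [this]
    rfl
  have h2 : (x : Plane) = 0 := by
    have h4 : (2 : ℝ) • (x : Plane) = 0 := by
      rw [two_smul]
      nth_rewrite 1 [h1]
      exact neg_add_cancel _
    simpa using h4
  have h3 := mem_sphere_zero_iff_norm.mp x.2
  rw [h2] at h3
  simp at h3

/-- The unit circle with a point removed embeds in the real line. -/
theorem exists_injOn_compl_singleton_sphere (y : Metric.sphere (0 : Plane) 1) :
    ∃ g : Metric.sphere (0 : Plane) 1 → ℝ, ContinuousOn g {y}ᶜ ∧ Set.InjOn g {y}ᶜ := by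
  have : Fact (Module.finrank ℝ Plane = 1 + 1) := ⟨by simp⟩
  obtain ⟨s, hs⟩ : ∃ s : OpenPartialHomeomorph (Metric.sphere (0 : Plane) 1)
      (EuclideanSpace ℝ (Fin 1)), s.source = {y}ᶜ :=
    ⟨stereographic' 1 y, stereographic'_source y⟩
  rw [← hs]
  have h0 : Continuous fun v : EuclideanSpace ℝ (Fin 1) => v 0 := by fun_prop
  refine ⟨fun x => s x 0, h0.comp_continuousOn s.continuousOn, ?_⟩
  intro a ha b hb hab
  apply s.injOn ha hb
  ext i
  fin_cases i
  exact hab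

/-- A continuous injective self-map of the unit circle is surjective. -/
theorem surjective_of_continuous_injective_sphere
    {f : Metric.sphere (0 : Plane) 1 → Metric.sphere (0 : Plane) 1}
    (hf : Continuous f) (hinj : Function.Injective f) : Function.Surjective f := by
  by_contra hs
  simp only [Function.Surjective, not_forall, not_exists] at hs
  obtain ⟨y, hy⟩ := hs
  obtain ⟨g, hg, hgi⟩ := exists_injOn_compl_singleton_sphere y
  refine not_injective_of_continuous_sphere_real (f := fun x => g (f x))
    (hg.comp_continuous hf hy) ?_
  intro a b hab
  exact hinj (hgi (hy a) (hy b) hab)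

/-- The identification of the Euclidean plane with the complex numbers. -/
noncomputable def planeEquivComplex : Plane ≃ₗᵢ[ℝ] ℂ := Complex.orthonormalBasisOneI.repr.symm

/-- A circle around a point `p` is not contractible in the complement of `p`. -/
theorem not_nullhomotopic_circle (p : Plane) (ε : ℝ) (hε : 0 < ε)
    (H : unitInterval × Metric.sphere (0 : Plane) 1 → Plane) (hH : Continuous H)
    (hne : ∀ x, H x ≠ p) (h0 : ∀ u v, H (0, u) = H (0, v))
    (h1 : ∀ u, H (1, u) = p + ε • (u : Plane)) : False := by
  obtain ⟨x₀, hx₀⟩ := isConnected_unit_sphere.nonempty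
  let a : Metric.sphere (0 : Plane) 1 := ⟨x₀, hx₀⟩
  let K : C(unitInterval × Metric.sphere (0 : Plane) 1, {z : ℂ // z ≠ 0}) :=
    ⟨fun x => ⟨planeEquivComplex (H x - p), by
      simpa [sub_eq_zero] using hne x⟩, by
      apply Continuous.subtype_mk
      exact planeEquivComplex.continuous.comp (hH.sub continuous_const)⟩
  have cov := Complex.isCoveringMap_exp
  let L₀ : ℂ := Complex.log (planeEquivComplex (H (0, a) - p))
  have hL₀ : ∀ u, K (0, u) = (⟨_, L₀.exp_ne_zero⟩ : {z : ℂ // z ≠ 0}) := by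
    intro u
    apply Subtype.ext
    simp only [K, ContinuousMap.coe_mk, L₀]
    rw [Complex.exp_log, h0 u a]
    simpa [sub_eq_zero] using hne (0, a)
  -- Lifting through `exp` gives a continuous logarithm, constant at time `0`. At time `1` its real
  -- part is constant on the circle, so its imaginary part would be injective there.
  let G := cov.liftHomotopy K (ContinuousMap.const _ L₀) hL₀
  have hG : ∀ x, Complex.exp (G x) = planeEquivComplex (H x - p) := fun x =>
    congrArg Subtype.val (congrFun (cov.liftHomotopy_lifts K (ContinuousMap.const _ L₀) hL₀) x)
  refine not_injective_of_continuous_sphere_real (f := fun u => (G (1, u)).im) ?_ ?_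
  · exact Complex.continuous_im.comp (G.continuous.comp (by fun_prop))
  · intro u v huv
    have key : ∀ w : Metric.sphere (0 : Plane) 1, Complex.exp (G (1, w)) =
        ε * planeEquivComplex (w : Plane) := by
      intro w
      rw [hG, h1, add_sub_cancel_left, map_smul, Complex.real_smul]
    have hre : ∀ w : Metric.sphere (0 : Plane) 1, Real.exp (G (1, w)).re = ε := by
      intro w
      have h2 := congrArg norm (key w)
      rw [Complex.norm_exp, norm_mul, LinearIsometryEquiv.norm_map,
        mem_sphere_zero_iff_norm.mp w.2] at h2
      simpa [abs_of_pos hε] using h2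
    have hre' : (G (1, u)).re = (G (1, v)).re := Real.exp_injective ((hre u).trans (hre v).symm)
    have heq : G (1, u) = G (1, v) := Complex.ext hre' huv
    have h3 := key u
    rw [heq, key v] at h3
    have h4 := mul_left_cancel₀ (Complex.ofReal_ne_zero.mpr hε.ne') h3
    exact Subtype.ext (planeEquivComplex.injective h4.symm)

/-- A point on the boundary curve of an embedded closed disk is not in the topological interior of
the disk. -/
theorem notMem_interior_range_of_norm_eq_one {f : ClosedDisk → Plane} (hf : Continuous f)
    (hinj : Function.Injective f) {x : ClosedDisk} (hx : ‖(x : Plane)‖ = 1) :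
    f x ∉ interior (Set.range f) := by
  intro hmem
  rw [mem_interior_iff_mem_nhds, Metric.mem_nhds_iff] at hmem
  obtain ⟨δ, hδ, hball⟩ := hmem
  have hc : ∀ u : Metric.sphere (0 : Plane) 1, f x + (δ / 2) • (u : Plane) ∈ Set.range f := by
    intro u
    apply hball
    rw [mem_ball_iff_norm, add_sub_cancel_left, norm_smul, mem_sphere_zero_iff_norm.mp u.2,
      Real.norm_of_nonneg (by positivity)]
    linarith
  have hemb : Topology.IsClosedEmbedding f := hf.isClosedEmbedding hinj
  let e := hemb.isEmbedding.toHomeomorph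
  -- If `f x` were interior, a small circle around it would lie in the image; pull this circle back
  -- to the disk.
  let k : Metric.sphere (0 : Plane) 1 → ClosedDisk := fun u => e.symm ⟨_, hc u⟩
  have hk : Continuous k := e.symm.continuous.comp (by fun_prop)
  have hfk : ∀ u, f (k u) = f x + (δ / 2) • (u : Plane) := by
    intro u
    have := e.apply_symm_apply ⟨_, hc u⟩
    exact congrArg Subtype.val this
  have hkx : ∀ u, k u ≠ x := by
    intro u hu
    have h1 := hfk u
    rw [hu, left_eq_add, smul_eq_zero] at h1
    rcases h1 with h1 | h1
    · linarith
    · have h3 := mem_sphere_zero_iff_norm.mp u.2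
      rw [h1] at h3
      simp at h3
  -- the segments from the center stay away from `x`
  have hconv : ∀ t : unitInterval, ∀ u,
      ((t : ℝ) • (k u : Plane)) ∈ Metric.closedBall (0 : Plane) 1 := by
    intro t u
    rw [mem_closedBall_zero_iff, norm_smul, Real.norm_of_nonneg t.2.1]
    have := mem_closedBall_zero_iff.mp (k u).2
    exact mul_le_one₀ t.2.2 (norm_nonneg _) this
  -- Radial shrinking in the disk contracts the pulled-back circle. It never meets `x`, since `x`
  -- has norm one and is reached only at time `1`, where `k u ≠ x`.
  refine not_nullhomotopic_circle (f x) (δ / 2) (by positivity)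
    (fun p => f ⟨(p.1 : ℝ) • (k p.2 : Plane), hconv p.1 p.2⟩) ?_ ?_ ?_ ?_
  · apply hf.comp
    apply Continuous.subtype_mk
    fun_prop
  · rintro ⟨t, u⟩ h
    have h1 := congrArg Subtype.val (hinj h)
    simp only at h1
    have h2 := mem_closedBall_zero_iff.mp (k u).2
    rw [← h1, norm_smul, Real.norm_of_nonneg t.2.1] at hx
    have h3 : (t : ℝ) = 1 := by
      have := t.2.2
      have := t.2.1
      nlinarith [norm_nonneg (k u : Plane)]
    rw [h3, one_smul] at h1
    exact hkx u (Subtype.ext h1)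
  · intro u v
    simp
  · intro u
    simp [hfk]

/-! ### Gluing local labellings over the plane -/

/-- Labellings modulo two of the members of a closed cover of the plane by connected sets, given
near each point and agreeing up to constants, come from one labelling of the cover: they define a
double covering of the plane, which has a section because the plane is simply connected. -/
theorem exists_global_labelling {ι : Type*} (tile : ι → Set Plane)
    (hcl : ∀ i, IsClosed (tile i)) (hconn : ∀ i, IsPreconnected (tile i))
    (hcov : ∀ p, ∃ i, p ∈ tile i) (hlf : LocallyFinite tile) (h : Plane → ι → ZMod 2)
    (hloc : ∀ p, ∀ᶠ q in 𝓝 p, ∀ i j, q ∈ tile i → q ∈ tile j → h q i - h q j = h p i - h p j) :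
    ∃ f : ι → ZMod 2, ∀ q i j, q ∈ tile i → q ∈ tile j → h q i - h q j = f i - f j := by
  have hsub : ∀ p, ∀ᶠ q in 𝓝 p, ∀ i, q ∈ tile i → p ∈ tile i := fun p => by
    filter_upwards [hlf.eventually_subset hcl p] with q hq i hi using hq hi
  have hB : ∀ p, ∃ B : Set Plane, IsOpen B ∧ p ∈ B ∧ ∀ q ∈ B,
      (∀ i j, q ∈ tile i → q ∈ tile j → h q i - h q j = h p i - h p j) := fun p => by
    obtain ⟨B, hB, hBo, hpB⟩ := eventually_nhds_iff.mp (hloc p)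
    exact ⟨B, hBo, hpB, hB⟩
  choose B hBo hpB hBh using hB
  choose c hc using hcov
  have hwd : ∀ p p' q, q ∈ B p → q ∈ B p' → ∀ i j, q ∈ tile i → q ∈ tile j →
      h p i - h p' i = h p j - h p' j := by
    intro p p' q hq hq' i j hi hj
    have h1 := hBh p q hq i j hi hj
    have h2 := hBh p' q hq' i j hi hj
    have h3 := h1.symm.trans h2
    rw [sub_eq_sub_iff_add_eq_add] at h3 ⊢
    linear_combination h3
  -- The charts at `p` and `p'` differ by `h p - h p'`, evaluated at any tile through `q`: by `hwd`
  -- the choice `c q` does not matter, so the transition functions are locally constant.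
  let Z : FiberBundleCore Plane Plane (ZMod 2) :=
    { baseSet := B
      isOpen_baseSet := hBo
      indexAt := id
      mem_baseSet_at := hpB
      coordChange := fun p p' q v => v + (h p (c q) - h p' (c q))
      coordChange_self := fun p q _ v => by simp
      continuousOn_coordChange := by
        intro p p'
        rintro ⟨q, v⟩ ⟨⟨hq, hq'⟩, -⟩
        apply ContinuousAt.continuousWithinAt
        have hev : (fun x : Plane × ZMod 2 => x.2 + (h p (c x.1) - h p' (c x.1))) =ᶠ[𝓝 (q, v)]
            fun x => x.2 + (h p (c q) - h p' (c q)) := by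
          have : ∀ᶠ y in 𝓝 q, h p (c y) - h p' (c y) = h p (c q) - h p' (c q) := by
            filter_upwards [hsub q] with y hy
            exact hwd p p' q hq hq' _ _ (hy _ (hc y)) (hc q)
          filter_upwards [continuous_fst.continuousAt.eventually this] with x hx
          rw [hx]
        rw [continuousAt_congr hev]
        fun_prop
      coordChange_comp := fun p p' p'' q _ v => by ring }
  have cov : IsCoveringMap (Bundle.TotalSpace.proj : Bundle.TotalSpace (ZMod 2) Z.Fiber → Plane) :=
    FiberBundle.isCoveringMap
  obtain ⟨F, ⟨-, hF⟩, -⟩ := cov.existsUnique_continuousMap_lifts (ContinuousMap.id Plane) 0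
    ⟨0, (0 : ZMod 2)⟩ rfl
  have hF1 : ∀ q, (F q).1 = q := fun q => congrFun hF q
  let s : Plane → ZMod 2 := fun q => (F q).2
  have hs : ∀ p, ∀ᶠ q in 𝓝 p, s q + (h q (c q) - h p (c q)) = s p := by
    intro p
    have h1 : ContinuousAt (fun q => (Z.localTriv p (F q)).2) p := by
      apply continuousAt_snd.comp
      refine ContinuousAt.comp (f := F) (g := Z.localTriv p) ?_ F.continuous.continuousAt
      apply (Z.localTriv p).continuousOn_toFun.continuousAt
      apply (Z.localTriv p).open_source.mem_nhds
      rw [Z.mem_localTriv_source, hF1]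
      exact hpB p
    have h2 : ∀ q, (Z.localTriv p (F q)).2 = s q + (h q (c q) - h p (c q)) := by
      intro q
      rw [Z.localTriv_apply]
      change s q + (h (F q).1 (c (F q).1) - h p (c (F q).1)) = _
      rw [hF1]
    have h3 : ∀ᶠ q in 𝓝 p, (Z.localTriv p (F q)).2 = (Z.localTriv p (F p)).2 :=
      h1.eventually (IsOpen.mem_nhds (isOpen_discrete {(Z.localTriv p (F p)).2}) rfl)
    filter_upwards [h3] with q hq
    rw [h2, h2] at hq
    rw [hq]
    ring
  -- The section `s` compensates the jumps of `h`, so `s q + h q i` is locally constant on the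
  -- connected tile `i`; its value is the global label.
  have hconst : ∀ i, ∃ a, ∀ q ∈ tile i, s q + h q i = a := by
    intro i
    have hct : ContinuousOn (fun q => s q + h q i) (tile i) := by
      intro p hp
      have hev : (fun q => s q + h q i) =ᶠ[𝓝[tile i] p] fun _ => s p + h p i := by
        filter_upwards [mem_nhdsWithin_of_mem_nhds (hs p), mem_nhdsWithin_of_mem_nhds (hloc p),
          self_mem_nhdsWithin] with q h1 h2 h3
        have h4 := h2 i (c q) h3 (hc q)
        rw [← h1]
        linear_combination h4
      exact (continuousWithinAt_const (b := s p + h p i)).congr_of_eventuallyEq hev rfl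
    rcases (tile i).eq_empty_or_nonempty with he | ⟨p, hp⟩
    · exact ⟨0, fun q hq => by simp [he] at hq⟩
    · exact ⟨_, fun q hq => (hconn i).constant hct hq hp⟩
  choose f hf using hconst
  refine ⟨f, fun q i j hi hj => ?_⟩
  rw [← hf i q hi, ← hf j q hj]
  ring

/-! ### Punctured disks and angles on the unit circle -/

/-- A disk of the plane with its center removed is connected. -/
theorem isPreconnected_ball_diff_center (p : Plane) {ε : ℝ} (hε : 0 < ε) :
    IsPreconnected (Metric.ball p ε \ {p}) := by
  have h1 : IsPreconnected ({0}ᶜ : Set Plane) :=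
    (isConnected_compl_singleton_of_one_lt_rank
      (by rw [← Module.finrank_eq_rank ℝ Plane]; simp) 0).isPreconnected
  have h2 : (OpenPartialHomeomorph.univBall p ε) '' ({0}ᶜ : Set Plane) =
      Metric.ball p ε \ {p} := by
    have hinj : Function.Injective (OpenPartialHomeomorph.univBall p ε) := by
      rw [← Set.injOn_univ]
      have := (OpenPartialHomeomorph.univBall p ε).injOn
      rwa [OpenPartialHomeomorph.univBall_source] at this
    rw [Set.compl_eq_univ_sdiff, Set.image_sdiff hinj, Set.image_singleton,
      OpenPartialHomeomorph.univBall_apply_zero]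
    congr 1
    have := (OpenPartialHomeomorph.univBall p ε).image_source_eq_target
    rwa [OpenPartialHomeomorph.univBall_source, OpenPartialHomeomorph.univBall_target _ hε] at this
  rw [← h2]
  exact h1.image _ (OpenPartialHomeomorph.continuous_univBall p ε).continuousOn

/-- The point of the closed unit disk at a given angle on the unit circle. -/
noncomputable def unitPoint (θ : ℝ) : ClosedDisk :=
  ⟨planeEquivComplex.symm (Circle.exp θ), by simp⟩

theorem continuous_unitPoint : Continuous unitPoint :=
  Continuous.subtype_mk (planeEquivComplex.symm.continuous.comp
    (continuous_subtype_val.comp Circle.exp.continuous)) _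

theorem norm_unitPoint (θ : ℝ) : ‖(unitPoint θ : Plane)‖ = 1 := by
  simp [unitPoint]

theorem unitPoint_eq_iff {s t : ℝ} :
    unitPoint s = unitPoint t ↔ ∃ m : ℤ, s = t + m * (2 * Real.pi) := by
  rw [← Circle.exp_eq_exp, Subtype.ext_iff]
  exact planeEquivComplex.symm.injective.eq_iff.trans Circle.coe_inj

theorem exists_unitPoint_eq {x : ClosedDisk} (hx : ‖(x : Plane)‖ = 1) :
    ∃ θ, unitPoint θ = x := by
  refine ⟨Complex.arg (planeEquivComplex x), Subtype.ext ?_⟩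
  rw [unitPoint]
  simp only [Circle.coe_exp]
  rw [LinearIsometryEquiv.symm_apply_eq]
  have := Complex.norm_mul_exp_arg_mul_I (planeEquivComplex x)
  rwa [LinearIsometryEquiv.norm_map, hx, Complex.ofReal_one, one_mul] at this

/-! ### Valences, boundary curves and vertices of a tile -/

namespace Tessellation

variable {ι : Type*} (T : Tessellation ι)

/-- The tiles that contain the point `p`. -/
def tilesAt (p : Plane) : Set ι := {i | p ∈ T.tile i}

theorem mem_tilesAt {p : Plane} {i : ι} : i ∈ T.tilesAt p ↔ p ∈ T.tile i := Iff.rfl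

theorem valence_eq (p : Plane) : T.valence p = (T.tilesAt p).ncard := rfl

theorem finite_tilesAt (p : Plane) : (T.tilesAt p).Finite := T.finite_tiles_at p

theorem isCompact_tile (i : ι) : IsCompact (T.tile i) := isCompact_range (T.continuous_param i)

theorem isClosed_tile (i : ι) : IsClosed (T.tile i) := (T.isCompact_tile i).isClosed

theorem isConnected_tile (i : ι) : IsConnected (T.tile i) := by
  have : ConnectedSpace ClosedDisk :=
    isConnected_iff_connectedSpace.mp (Metric.isConnected_closedBall zero_le_one)
  exact isConnected_range (T.continuous_param i)

theorem nontrivial_tile (i : ι) : (T.tile i).Nontrivial := by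
  refine ⟨_, ⟨unitPoint 0, rfl⟩, _, ⟨⟨0, by simp⟩, rfl⟩, ?_⟩
  intro h
  have h1 := T.injective_param i h
  have h2 := norm_unitPoint 0
  rw [h1] at h2
  simp at h2

theorem exists_mem_tile (p : Plane) : ∃ i, p ∈ T.tile i := by
  have hx : p ∈ ⋃ i, Set.range (T.param i) := T.covers ▸ Set.mem_univ p
  exact Set.mem_iUnion.1 hx

theorem valence_pos (p : Plane) : 0 < T.valence p :=
  (Set.ncard_pos (T.finite_tilesAt p)).mpr (T.exists_mem_tile p)

theorem eventually_tilesAt_subset (p : Plane) : ∀ᶠ q in 𝓝 p, T.tilesAt q ⊆ T.tilesAt p :=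
  T.locallyFinite.eventually_subset T.isClosed_tile p

/-- Finitely many tiles do not cover the plane. -/
theorem exists_notMem_of_finite {C : Set ι} (hC : C.Finite) :
    ∃ p, ∀ i ∈ C, p ∉ T.tile i := by
  by_contra! h
  have h1 : IsCompact (⋃ i ∈ C, T.tile i) := hC.isCompact_biUnion fun i _ => T.isCompact_tile i
  have h2 : (⋃ i ∈ C, T.tile i) = Set.univ := by
    ext p
    simpa using h p
  rw [h2] at h1
  exact noncompact_univ Plane h1

/-- The boundary curve of a tile. -/
def boundary (i : ι) : Set Plane := T.param i '' {x | ‖(x : Plane)‖ = 1}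

theorem boundary_subset_tile (i : ι) : T.boundary i ⊆ T.tile i := by
  rintro _ ⟨x, -, rfl⟩
  exact ⟨x, rfl⟩

theorem mem_boundary_of_mem {i j : ι} (hij : i ≠ j) {p : Plane} (hi : p ∈ T.tile i)
    (hj : p ∈ T.tile j) : p ∈ T.boundary i := by
  obtain ⟨x, rfl⟩ := hi
  exact ⟨x, T.no_overlap i j hij x hj, rfl⟩

theorem two_le_valence_iff {p : Plane} : 2 ≤ T.valence p ↔ ∃ i j, i ≠ j ∧ p ∈ T.tile i ∧
    p ∈ T.tile j := by
  rw [valence_eq, Nat.succ_le_iff, Set.one_lt_ncard_iff (T.finite_tilesAt p)]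
  simp only [mem_tilesAt]
  constructor
  · rintro ⟨a, b, h1, h2, h3⟩; exact ⟨a, b, h3, h1, h2⟩
  · rintro ⟨a, b, h3, h1, h2⟩; exact ⟨a, b, h1, h2, h3⟩

theorem tilesAt_eq_singleton {p : Plane} (h : ¬ 2 ≤ T.valence p) {i : ι} (hi : p ∈ T.tile i) :
    T.tilesAt p = {i} := by
  ext j
  rw [mem_tilesAt, Set.mem_singleton_iff]
  constructor
  · intro hj
    by_contra hne
    exact h (T.two_le_valence_iff.mpr ⟨j, i, hne, hj, hi⟩)
  · rintro rfl
    exact hi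

/-- If only the tile `i` contained `p`, local finiteness would make it a neighborhood of `p`, which
is impossible on its boundary curve. The converse is the absence of overlaps. -/
theorem mem_boundary_iff {i : ι} {p : Plane} (hi : p ∈ T.tile i) :
    p ∈ T.boundary i ↔ 2 ≤ T.valence p := by
  constructor
  · rintro ⟨x, hx, rfl⟩
    by_contra hv
    have h1 := T.tilesAt_eq_singleton hv hi
    apply notMem_interior_range_of_norm_eq_one (T.continuous_param i) (T.injective_param i) hx
    rw [mem_interior_iff_mem_nhds]
    filter_upwards [T.eventually_tilesAt_subset (T.param i x)] with q hq
    obtain ⟨j, hj⟩ := T.exists_mem_tile q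
    have h2 := hq hj
    rw [h1, Set.mem_singleton_iff] at h2
    exact h2 ▸ hj
  · intro h
    obtain ⟨a, b, hab, ha, hb⟩ := T.two_le_valence_iff.mp h
    rcases eq_or_ne i a with rfl | hne
    · exact T.mem_boundary_of_mem hab ha hb
    · exact T.mem_boundary_of_mem hne hi ha

theorem tilesAt_eq_pair {p : Plane} (h : T.valence p = 2) {i j : ι} (hij : i ≠ j)
    (hi : p ∈ T.tile i) (hj : p ∈ T.tile j) : T.tilesAt p = {i, j} := by
  symm
  apply Set.eq_of_subset_of_ncard_le _ _ (T.finite_tilesAt p)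
  · rintro k (rfl | rfl) <;> assumption
  · rw [Set.ncard_pair hij, ← valence_eq, h]

/-- The tiles meeting at the points of a connected set of points of valence two are the same. -/
theorem tilesAt_eq_of_isPreconnected {D : Set Plane} (hD : IsPreconnected D)
    (hv : ∀ p ∈ D, T.valence p = 2) {p q : Plane} (hp : p ∈ D) (hq : q ∈ D) :
    T.tilesAt p = T.tilesAt q := by
  refine hD.induction₂ (fun x y => T.tilesAt x = T.tilesAt y) ?_ ?_ ?_ hp hq
  · intro x hx
    filter_upwards [mem_nhdsWithin_of_mem_nhds (T.eventually_tilesAt_subset x),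
      self_mem_nhdsWithin] with y hy hyD
    symm
    apply Set.eq_of_subset_of_ncard_le hy _ (T.finite_tilesAt x)
    rw [← valence_eq, ← valence_eq, hv x hx, hv y hyD]
  · intro x y z _ _ _ h1 h2
    exact h1.trans h2
  · intro x y _ _ h
    exact h.symm

/-- An inclusion of boundary curves induces a continuous injective self-map of the circle, and such
a map is onto. -/
theorem boundary_subset_boundary_symm {i j : ι} (h : T.boundary i ⊆ T.boundary j) :
    T.boundary j ⊆ T.boundary i := by
  have hsub : ∀ u : Metric.sphere (0 : Plane) 1, ∃ w : Metric.sphere (0 : Plane) 1,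
      T.param j ⟨w, Metric.sphere_subset_closedBall w.2⟩ =
        T.param i ⟨u, Metric.sphere_subset_closedBall u.2⟩ := by
    intro u
    obtain ⟨x, hx, hxe⟩ := h ⟨⟨u, Metric.sphere_subset_closedBall u.2⟩,
      mem_sphere_zero_iff_norm.mp u.2, rfl⟩
    exact ⟨⟨x, mem_sphere_zero_iff_norm.mpr hx⟩, hxe⟩
  choose σ hσ using hsub
  have hemb : Topology.IsEmbedding fun w : Metric.sphere (0 : Plane) 1 =>
      T.param j ⟨w, Metric.sphere_subset_closedBall w.2⟩ :=
    ((T.continuous_param j).isClosedEmbedding (T.injective_param j)).isEmbedding.comp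
      (Topology.IsEmbedding.inclusion Metric.sphere_subset_closedBall)
  have hσc : Continuous σ := by
    rw [hemb.continuous_iff]
    have : ((fun w : Metric.sphere (0 : Plane) 1 =>
        T.param j ⟨w, Metric.sphere_subset_closedBall w.2⟩) ∘ σ) =
        fun u : Metric.sphere (0 : Plane) 1 =>
          T.param i ⟨u, Metric.sphere_subset_closedBall u.2⟩ := funext hσ
    rw [this]
    exact (T.continuous_param i).comp (continuous_inclusion Metric.sphere_subset_closedBall)
  have hσi : Function.Injective σ := by
    intro a b hab
    have h1 := (hσ a).symm.trans ((congrArg _ (by rw [hab])).trans (hσ b))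
    exact Subtype.ext (Subtype.mk.inj (T.injective_param i h1))
  rintro _ ⟨x, hx, rfl⟩
  obtain ⟨u, hu⟩ := surjective_of_continuous_injective_sphere hσc hσi
    ⟨x, mem_sphere_zero_iff_norm.mpr hx⟩
  refine ⟨⟨u, Metric.sphere_subset_closedBall u.2⟩, mem_sphere_zero_iff_norm.mp u.2, ?_⟩
  rw [← hσ u, hu]

/-- The parametrization of the boundary curve of a tile by the angle. -/
noncomputable def curve (i : ι) (θ : ℝ) : Plane := T.param i (unitPoint θ)

theorem continuous_curve (i : ι) : Continuous (T.curve i) :=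
  (T.continuous_param i).comp continuous_unitPoint

theorem curve_eq_iff {i : ι} {s t : ℝ} :
    T.curve i s = T.curve i t ↔ ∃ m : ℤ, s = t + m * (2 * Real.pi) := by
  rw [curve, curve, (T.injective_param i).eq_iff, unitPoint_eq_iff]

theorem curve_add_two_pi (i : ι) (s : ℝ) : T.curve i (s + 2 * Real.pi) = T.curve i s :=
  T.curve_eq_iff.mpr ⟨1, by simp⟩

theorem curve_ne_of_lt {i : ι} {s t : ℝ} (h : s < t) (h' : t < s + 2 * Real.pi) :
    T.curve i s ≠ T.curve i t := by
  intro he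
  obtain ⟨m, hm⟩ := T.curve_eq_iff.mp he.symm
  have h1 : (0 : ℝ) < m * (2 * Real.pi) := by linarith
  have h2 : (m : ℝ) * (2 * Real.pi) < 1 * (2 * Real.pi) := by linarith
  have h3 : 0 < m := by exact_mod_cast pos_of_mul_pos_left h1 Real.two_pi_pos.le
  have h4 : m < 1 := by exact_mod_cast lt_of_mul_lt_mul_right h2 Real.two_pi_pos.le
  omega

theorem curve_mem_boundary (i : ι) (θ : ℝ) : T.curve i θ ∈ T.boundary i :=
  ⟨_, norm_unitPoint θ, rfl⟩

theorem curve_mem_tile (i : ι) (θ : ℝ) : T.curve i θ ∈ T.tile i := ⟨_, rfl⟩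

theorem exists_curve_eq {i : ι} {p : Plane} (h : p ∈ T.boundary i) (a : ℝ) :
    ∃ θ ∈ Set.Ioc a (a + 2 * Real.pi), T.curve i θ = p := by
  obtain ⟨x, hx, rfl⟩ := h
  obtain ⟨θ, rfl⟩ := exists_unitPoint_eq hx
  refine ⟨toIocMod Real.two_pi_pos a θ, toIocMod_mem_Ioc _ _ _, ?_⟩
  change T.curve i _ = T.curve i _
  rw [curve_eq_iff]
  refine ⟨-toIocDiv Real.two_pi_pos a θ, ?_⟩
  have := self_sub_toIocDiv_zsmul Real.two_pi_pos a θ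
  rw [← this, zsmul_eq_mul]
  push_cast
  ring

theorem mem_vertices {i : ι} {p : Plane} :
    p ∈ T.vertices i ↔ p ∈ T.tile i ∧ 3 ≤ T.valence p := Iff.rfl

theorem valence_curve_eq_two {i : ι} {θ : ℝ} (h : T.curve i θ ∉ T.vertices i) :
    T.valence (T.curve i θ) = 2 := by
  have h1 := (T.mem_boundary_iff (T.curve_mem_tile i θ)).mp (T.curve_mem_boundary i θ)
  have h2 : ¬ 3 ≤ T.valence (T.curve i θ) := fun h3 => h ⟨T.curve_mem_tile i θ, h3⟩
  omega

/-- Every tile has at least two vertices. -/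
theorem exists_vertex_ne (i : ι) (v : Plane) : ∃ w ∈ T.vertices i, w ≠ v := by
  by_contra! hv
  -- All vertices lie at the single angle `α`. If `v` is off the curve, there are no vertices at all
  -- and any angle will do.
  obtain ⟨α, hα⟩ : ∃ α, ∀ w ∈ T.vertices i, w = T.curve i α := by
    by_cases hb : v ∈ T.boundary i
    · obtain ⟨α, -, hα⟩ := T.exists_curve_eq hb 0
      exact ⟨α, fun w hw => (hv w hw).trans hα.symm⟩
    · refine ⟨0, fun w hw => absurd ?_ hb⟩
      rw [← hv w hw, T.mem_boundary_iff hw.1]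
      exact (Nat.le_succ 2).trans hw.2
  -- The curve without its point at `α` is connected and has valence two, so a single tile `j` lies
  -- across all of it; the boundary curves of `i` and `j` then coincide.
  let D : Set Plane := T.curve i '' Set.Ioo α (α + 2 * Real.pi)
  have hDc : IsPreconnected D := isPreconnected_Ioo.image _ (T.continuous_curve i).continuousOn
  have hbD : ∀ p ∈ T.boundary i, p ≠ T.curve i α → p ∈ D := by
    intro p hp hne
    obtain ⟨θ, hθ, rfl⟩ := T.exists_curve_eq hp α
    refine ⟨θ, ⟨hθ.1, lt_of_le_of_ne hθ.2 ?_⟩, rfl⟩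
    rintro rfl
    exact hne (T.curve_add_two_pi i α)
  have hDv : ∀ p ∈ D, T.valence p = 2 := by
    rintro _ ⟨θ, hθ, rfl⟩
    apply T.valence_curve_eq_two
    intro hmem
    exact T.curve_ne_of_lt hθ.1 hθ.2 (hα _ hmem).symm
  have hx₀ : T.curve i (α + Real.pi) ∈ D :=
    ⟨_, ⟨by linarith [Real.pi_pos], by linarith [Real.pi_pos]⟩, rfl⟩
  obtain ⟨j, hij, hj⟩ : ∃ j, i ≠ j ∧ T.curve i (α + Real.pi) ∈ T.tile j := by
    have h2 := hDv _ hx₀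
    obtain ⟨a, b, hab, ha, hb⟩ := T.two_le_valence_iff.mp h2.ge
    rcases eq_or_ne i a with rfl | hne
    · exact ⟨b, hab, hb⟩
    · exact ⟨a, hne, ha⟩
  have hDt : ∀ p ∈ D, T.tilesAt p = {i, j} := fun p hp => by
    rw [T.tilesAt_eq_of_isPreconnected hDc hDv hp hx₀]
    exact T.tilesAt_eq_pair (hDv _ hx₀) hij (T.curve_mem_tile i _) hj
  have hDj : D ⊆ T.tile j := fun p hp => by
    rw [← mem_tilesAt, hDt p hp]
    simp
  have hij_sub : T.curve i '' Set.Icc α (α + 2 * Real.pi) ⊆ T.tile j := by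
    rw [← closure_Ioo (by linarith [Real.two_pi_pos] : α ≠ α + 2 * Real.pi)]
    exact (image_closure_subset_closure_image (T.continuous_curve i)).trans
      (closure_minimal hDj (T.isClosed_tile j))
  have hbj : T.boundary i ⊆ T.boundary j := by
    intro p hp
    obtain ⟨θ, hθ, rfl⟩ := T.exists_curve_eq hp α
    exact T.mem_boundary_of_mem hij.symm (hij_sub ⟨θ, Set.Ioc_subset_Icc_self hθ, rfl⟩)
      (T.curve_mem_tile i θ)
  have hbi := T.boundary_subset_boundary_symm hbj
  have hopen : ∀ p, p ∈ T.tile i ∨ p ∈ T.tile j → p ≠ T.curve i α →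
      T.tilesAt p ⊆ {i, j} := by
    intro p hp hne
    by_cases h2 : 2 ≤ T.valence p
    · have hpb : p ∈ T.boundary i := by
        rcases hp with hp | hp
        · exact (T.mem_boundary_iff hp).mpr h2
        · exact hbi ((T.mem_boundary_iff hp).mpr h2)
      exact (hDt p (hbD p hpb hne)).subset
    · rcases hp with hp | hp
      · rw [T.tilesAt_eq_singleton h2 hp]; simp
      · rw [T.tilesAt_eq_singleton h2 hp]; simp
  -- Away from one point, the union of the two tiles is open as well as closed. It thus fills the
  -- punctured plane, although two tiles cannot cover the plane.
  have hconn : IsPreconnected ({T.curve i α}ᶜ : Set Plane) :=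
    (isConnected_compl_singleton_of_one_lt_rank
      (by rw [← Module.finrank_eq_rank ℝ Plane]; simp) _).isPreconnected
  have hall : ∀ p, p ≠ T.curve i α → p ∈ T.tile i ∨ p ∈ T.tile j := by
    intro p hp
    have hx₀ne : T.curve i (α + Real.pi) ≠ T.curve i α :=
      (T.curve_ne_of_lt (by linarith [Real.pi_pos]) (by linarith [Real.pi_pos])).symm
    have key := hconn.induction₂ (fun x y => (x ∈ T.tile i ∨ x ∈ T.tile j) ↔
      (y ∈ T.tile i ∨ y ∈ T.tile j)) ?_ ?_ ?_ hx₀ne hp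
    · exact key.mp (Or.inl (T.curve_mem_tile i _))
    · intro x hx
      by_cases hxW : x ∈ T.tile i ∨ x ∈ T.tile j
      · filter_upwards [mem_nhdsWithin_of_mem_nhds (T.eventually_tilesAt_subset x)] with y hy
        refine iff_of_true hxW ?_
        obtain ⟨k, hk⟩ := T.exists_mem_tile y
        rcases hopen x hxW hx (hy hk) with rfl | rfl
        · exact Or.inl hk
        · exact Or.inr hk
      · filter_upwards [mem_nhdsWithin_of_mem_nhds (T.eventually_tilesAt_subset x)] with y hy
        refine iff_of_false hxW ?_
        rintro (h | h)
        · exact hxW (Or.inl (hy h))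
        · exact hxW (Or.inr (hy h))
    · intro x y z _ _ _ h1 h2
      exact h1.trans h2
    · intro x y _ _ h
      exact h.symm
  obtain ⟨p, hp⟩ := T.exists_notMem_of_finite (Set.toFinite {i, j})
  by_cases hpe : p = T.curve i α
  · exact hp i (by simp) (hpe ▸ T.curve_mem_tile i α)
  · rcases hall p hpe with h | h
    · exact hp i (by simp) h
    · exact hp j (by simp) h

/-! ### Edges as arcs between consecutive vertices -/

theorem edge_isPreconnected {e : Set Plane} (he : e ∈ T.edges) : IsPreconnected e := by
  obtain ⟨p, -, rfl⟩ := he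
  exact isPreconnected_connectedComponentIn

theorem valence_of_mem_edge {e : Set Plane} (he : e ∈ T.edges) {q : Plane} (hq : q ∈ e) :
    T.valence q = 2 := by
  obtain ⟨p, -, rfl⟩ := he
  exact connectedComponentIn_subset {q | T.valence q = 2} p hq

theorem edge_nonempty {e : Set Plane} (he : e ∈ T.edges) : e.Nonempty := by
  obtain ⟨p, hp, rfl⟩ := he
  exact ⟨p, mem_connectedComponentIn hp⟩

theorem edge_eq_component {e : Set Plane} (he : e ∈ T.edges) {q : Plane} (hq : q ∈ e) :
    e = connectedComponentIn {q | T.valence q = 2} q := by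
  obtain ⟨p, -, rfl⟩ := he
  exact connectedComponentIn_eq hq

theorem edge_eq_of_mem {e e' : Set Plane} (he : e ∈ T.edges) (he' : e' ∈ T.edges) {q : Plane}
    (hq : q ∈ e) (hq' : q ∈ e') : e = e' := by
  rw [T.edge_eq_component he hq, T.edge_eq_component he' hq']

theorem exists_edge_mem {q : Plane} (hq : T.valence q = 2) : ∃ e ∈ T.edges, q ∈ e :=
  ⟨_, ⟨q, hq, rfl⟩, mem_connectedComponentIn hq⟩

theorem edge_subset_iff {e : Set Plane} (he : e ∈ T.edges) {q : Plane} (hq : q ∈ e) {i : ι} :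
    e ⊆ T.tile i ↔ q ∈ T.tile i := by
  constructor
  · intro h
    exact h hq
  · intro hi p hp
    rw [← mem_tilesAt, T.tilesAt_eq_of_isPreconnected (T.edge_isPreconnected he)
      (fun x hx => T.valence_of_mem_edge he hx) hp hq]
    exact hi

/-- Every edge lies in exactly two tiles. -/
theorem exists_tiles_of_edge {e : Set Plane} (he : e ∈ T.edges) :
    ∃ i j, i ≠ j ∧ ∀ k, e ⊆ T.tile k ↔ k = i ∨ k = j := by
  obtain ⟨q, hq⟩ := T.edge_nonempty he
  have h2 := T.valence_of_mem_edge he hq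
  obtain ⟨i, j, hij, hi, hj⟩ := T.two_le_valence_iff.mp h2.ge
  refine ⟨i, j, hij, fun k => ?_⟩
  rw [T.edge_subset_iff he hq, ← mem_tilesAt, T.tilesAt_eq_pair h2 hij hi hj]
  simp

theorem closure_edge_subset {e : Set Plane} {i : ι} (h : e ⊆ T.tile i) :
    closure e ⊆ T.tile i :=
  closure_minimal h (T.isClosed_tile i)

/-- The angles `α < β` of two consecutive vertices on the boundary curve of the tile `i`. -/
structure IsGap (i : ι) (α β : ℝ) : Prop where
  lt : α < β
  left : T.curve i α ∈ T.vertices i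
  right : T.curve i β ∈ T.vertices i
  between : ∀ θ ∈ Set.Ioo α β, T.curve i θ ∉ T.vertices i

variable {T}

/-- A second vertex stops the gap before a full turn, so the two ends of an edge are distinct
points. -/
theorem IsGap.lt_two_pi {i : ι} {α β : ℝ} (h : T.IsGap i α β) : β < α + 2 * Real.pi := by
  obtain ⟨w, hw, hne⟩ := T.exists_vertex_ne i (T.curve i α)
  have hwb : w ∈ T.boundary i :=
    (T.mem_boundary_iff hw.1).mpr ((Nat.le_succ 2).trans hw.2)
  obtain ⟨θ, hθ, rfl⟩ := T.exists_curve_eq hwb α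
  have h1 : θ ≠ α + 2 * Real.pi := by
    rintro rfl
    exact hne (T.curve_add_two_pi i α)
  by_contra! h2
  exact h.between θ ⟨hθ.1, (lt_of_le_of_ne hθ.2 h1).trans_le h2⟩ hw

variable (T)

theorem finite_vertex_angles (i : ι) (a : ℝ) :
    {θ | θ ∈ Set.Ioc a (a + 2 * Real.pi) ∧ T.curve i θ ∈ T.vertices i}.Finite := by
  apply Set.Finite.of_finite_image (f := T.curve i)
  · apply (T.vertices_finite i).subset
    rintro _ ⟨θ, hθ, rfl⟩
    exact hθ.2
  · rintro s ⟨hs, -⟩ t ⟨ht, -⟩ hst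
    by_contra hne
    rcases lt_or_gt_of_ne hne with h | h
    · exact T.curve_ne_of_lt h (by linarith [hs.1, ht.2]) hst
    · exact T.curve_ne_of_lt h (by linarith [ht.1, hs.2]) hst.symm

theorem exists_vertex_angle (i : ι) (a : ℝ) :
    ∃ θ ∈ Set.Ioc a (a + 2 * Real.pi), T.curve i θ ∈ T.vertices i := by
  obtain ⟨w, hw, -⟩ := T.exists_vertex_ne i 0
  have hwb : w ∈ T.boundary i :=
    (T.mem_boundary_iff hw.1).mpr ((Nat.le_succ 2).trans hw.2)
  obtain ⟨θ, hθ, rfl⟩ := T.exists_curve_eq hwb a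
  exact ⟨θ, hθ, hw⟩

/-- There is a next vertex after every angle. -/
theorem exists_next (i : ι) (a : ℝ) : ∃ β, a < β ∧ T.curve i β ∈ T.vertices i ∧
    ∀ θ ∈ Set.Ioo a β, T.curve i θ ∉ T.vertices i := by
  obtain ⟨θ₀, hθ₀, hv⟩ := T.exists_vertex_angle i a
  obtain ⟨β, hβ, hmin⟩ := Set.exists_min_image _ id (T.finite_vertex_angles i a) ⟨θ₀, hθ₀, hv⟩
  refine ⟨β, hβ.1.1, hβ.2, fun θ hθ hmem => ?_⟩
  have := hmin θ ⟨⟨hθ.1, hθ.2.le.trans hβ.1.2⟩, hmem⟩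
  exact absurd hθ.2 (not_lt.mpr this)

/-- There is a last vertex before every angle. -/
theorem exists_prev (i : ι) (b : ℝ) : ∃ α, α < b ∧ T.curve i α ∈ T.vertices i ∧
    ∀ θ ∈ Set.Ioo α b, T.curve i θ ∉ T.vertices i := by
  -- Going back two turns yields an angle at most `b - 2π`; the half-open interval one turn back
  -- could return `b` itself.
  obtain ⟨θ₁, hθ₁, hv⟩ := T.exists_vertex_angle i (b - 2 * (2 * Real.pi))
  have hpi := Real.pi_pos
  -- a vertex strictly before `b`, less than two turns away
  have hfin : {θ | θ ∈ Set.Ico θ₁ b ∧ T.curve i θ ∈ T.vertices i}.Finite := by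
    apply ((T.finite_vertex_angles i (b - 2 * (2 * Real.pi))).union
      (T.finite_vertex_angles i (b - 2 * Real.pi))).subset
    rintro θ ⟨hθ, hm⟩
    rcases le_or_gt θ (b - 2 * Real.pi) with h | h
    · exact Or.inl ⟨⟨hθ₁.1.trans_le hθ.1, by linarith⟩, hm⟩
    · exact Or.inr ⟨⟨h, by linarith [hθ.2]⟩, hm⟩
  obtain ⟨α, hα, hmax⟩ := Set.exists_max_image _ id hfin
    ⟨θ₁, ⟨le_rfl, by linarith [hθ₁.2]⟩, hv⟩
  refine ⟨α, hα.1.2, hα.2, fun θ hθ hmem => ?_⟩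
  have := hmax θ ⟨⟨hα.1.1.trans hθ.1.le, hθ.2⟩, hmem⟩
  exact absurd hθ.1 (not_lt.mpr this)

theorem exists_isGap_right {i : ι} {α : ℝ} (h : T.curve i α ∈ T.vertices i) :
    ∃ β, T.IsGap i α β := by
  obtain ⟨β, h1, h2, h3⟩ := T.exists_next i α
  exact ⟨β, h1, h, h2, h3⟩

theorem exists_isGap_left {i : ι} {β : ℝ} (h : T.curve i β ∈ T.vertices i) :
    ∃ α, T.IsGap i α β := by
  obtain ⟨α, h1, h2, h3⟩ := T.exists_prev i β
  exact ⟨α, h1, h2, h, h3⟩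

theorem exists_isGap_mem {i : ι} {θ : ℝ} (h : T.curve i θ ∉ T.vertices i) :
    ∃ α β, T.IsGap i α β ∧ θ ∈ Set.Ioo α β := by
  obtain ⟨β, h1, h2, h3⟩ := T.exists_next i θ
  obtain ⟨α, h4, h5, h6⟩ := T.exists_prev i θ
  refine ⟨α, β, ⟨h4.trans h1, h5, h2, fun t ht => ?_⟩, h4, h1⟩
  rcases lt_trichotomy t θ with h7 | rfl | h7
  · exact h6 t ⟨ht.1, h7⟩
  · exact h
  · exact h3 t ⟨h7, ht.2⟩

variable {T}

theorem notMem_edge_of_mem_vertices {e : Set Plane} (he : e ∈ T.edges) {v : Plane} {i : ι}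
    (hv : v ∈ T.vertices i) : v ∉ e := by
  intro h
  have := T.valence_of_mem_edge he h
  have := hv.2
  omega

theorem edge_subset_boundary {e : Set Plane} (he : e ∈ T.edges) {i : ι} (hi : e ⊆ T.tile i) :
    e ⊆ T.boundary i := fun _ hq =>
  (T.mem_boundary_iff (hi hq)).mpr (T.valence_of_mem_edge he hq).ge

/-- An edge of the tile `i` that meets the arc of a gap is this arc. -/
theorem IsGap.eq_edge {i : ι} {α β : ℝ} (h : T.IsGap i α β) {e : Set Plane} (he : e ∈ T.edges)
    {θ : ℝ} (hθ : θ ∈ Set.Ioo α β) (hθe : T.curve i θ ∈ e) : e = T.curve i '' Set.Ioo α β := by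
  have hi : e ⊆ T.tile i := (T.edge_subset_iff he hθe).mpr (T.curve_mem_tile i θ)
  apply Set.Subset.antisymm
  · have hK : ∀ a b : ℝ, IsClosed (T.curve i '' Set.Icc a b) := fun a b =>
      (isCompact_Icc.image (T.continuous_curve i)).isClosed
    -- The closed arc of the gap and the closed complementary arc cover `e` and meet only in
    -- vertices. As `e` is connected and contains no vertex, it stays in one of them.
    have hcov : e ⊆ T.curve i '' Set.Icc α β ∪ T.curve i '' Set.Icc β (α + 2 * Real.pi) := by
      intro q hq
      obtain ⟨t, ht, rfl⟩ := T.exists_curve_eq (edge_subset_boundary he hi hq) α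
      rcases le_total t β with h1 | h1
      · exact Or.inl ⟨t, ⟨ht.1.le, h1⟩, rfl⟩
      · exact Or.inr ⟨t, ⟨h1, ht.2⟩, rfl⟩
    have hend : ∀ t, t = α ∨ t = β → T.curve i t ∉ e := by
      rintro t (rfl | rfl)
      · exact notMem_edge_of_mem_vertices he h.left
      · exact notMem_edge_of_mem_vertices he h.right
    intro q hq
    rcases hcov hq with ⟨t, ht, rfl⟩ | hq2
    · refine ⟨t, ⟨lt_of_le_of_ne ht.1 ?_, lt_of_le_of_ne ht.2 ?_⟩, rfl⟩
      · rintro rfl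
        exact hend _ (Or.inl rfl) hq
      · rintro rfl
        exact hend _ (Or.inr rfl) hq
    · exfalso
      obtain ⟨r, hre, ⟨s, hs, rfl⟩, ⟨t, ht, hst⟩⟩ :=
        isPreconnected_closed_iff.mp (T.edge_isPreconnected he) _ _ (hK _ _) (hK _ _) hcov
          ⟨_, hθe, θ, Set.Ioo_subset_Icc_self hθ, rfl⟩ ⟨q, hq, hq2⟩
      have hsα : s ≠ α := fun h' => hend s (Or.inl h') hre
      have hsβ : s ≠ β := fun h' => hend s (Or.inr h') hre
      have hs1 : α < s := lt_of_le_of_ne hs.1 hsα.symm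
      have hs2 : s < β := lt_of_le_of_ne hs.2 hsβ
      exact T.curve_ne_of_lt (hs2.trans_le ht.1) (by linarith [ht.2]) hst.symm
  · rw [T.edge_eq_component he hθe]
    apply IsPreconnected.subset_connectedComponentIn
    · exact isPreconnected_Ioo.image _ (T.continuous_curve i).continuousOn
    · exact ⟨θ, hθ, rfl⟩
    · rintro _ ⟨t, ht, rfl⟩
      exact T.valence_curve_eq_two (h.between t ht)

theorem IsGap.edge_mem {i : ι} {α β : ℝ} (h : T.IsGap i α β) :
    T.curve i '' Set.Ioo α β ∈ T.edges := by
  obtain ⟨θ, hθ⟩ := Set.nonempty_Ioo.mpr h.lt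
  obtain ⟨e, he, hq⟩ := T.exists_edge_mem (T.valence_curve_eq_two (h.between θ hθ))
  rw [← h.eq_edge he hθ hq]
  exact he

theorem IsGap.edge_subset {i : ι} {α β : ℝ} : T.curve i '' Set.Ioo α β ⊆ T.tile i := by
  rintro _ ⟨t, -, rfl⟩
  exact T.curve_mem_tile i t

theorem exists_isGap_of_edge {i : ι} {e : Set Plane} (he : e ∈ T.edges) (hi : e ⊆ T.tile i) :
    ∃ α β, T.IsGap i α β ∧ e = T.curve i '' Set.Ioo α β := by
  obtain ⟨q, hq⟩ := T.edge_nonempty he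
  obtain ⟨θ, -, rfl⟩ := T.exists_curve_eq (edge_subset_boundary he hi hq) 0
  obtain ⟨α, β, hg, hθ⟩ := T.exists_isGap_mem (i := i) (θ := θ)
    fun hv => notMem_edge_of_mem_vertices he hv hq
  exact ⟨α, β, hg, hg.eq_edge he hθ hq⟩

theorem IsGap.closure_edge {i : ι} {α β : ℝ} (h : T.IsGap i α β) :
    closure (T.curve i '' Set.Ioo α β) = T.curve i '' Set.Icc α β := by
  apply Set.Subset.antisymm
  · exact closure_minimal (Set.image_mono Set.Ioo_subset_Icc_self)
      (isCompact_Icc.image (T.continuous_curve i)).isClosed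
  · rw [← closure_Ioo h.lt.ne]
    exact image_closure_subset_closure_image (T.continuous_curve i)

theorem IsGap.mem_closure_iff {i : ι} {α β : ℝ} (h : T.IsGap i α β) {v : Plane}
    (hv : 3 ≤ T.valence v) :
    v ∈ closure (T.curve i '' Set.Ioo α β) ↔ v = T.curve i α ∨ v = T.curve i β := by
  rw [h.closure_edge]
  constructor
  · rintro ⟨t, ht, rfl⟩
    rcases eq_or_lt_of_le ht.1 with rfl | h1
    · exact Or.inl rfl
    rcases eq_or_lt_of_le ht.2 with rfl | h2
    · exact Or.inr rfl
    · have := T.valence_curve_eq_two (h.between t ⟨h1, h2⟩)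
      omega
  · rintro (rfl | rfl)
    · exact ⟨α, ⟨le_rfl, h.lt.le⟩, rfl⟩
    · exact ⟨β, ⟨h.lt.le, le_rfl⟩, rfl⟩

/-- Closing the arc of a gap adds only its two ends, and these have valence at least three. -/
theorem mem_edge_of_mem_closure {e : Set Plane} (he : e ∈ T.edges) {q : Plane}
    (hq : q ∈ closure e) (hv : T.valence q ≤ 2) : q ∈ e := by
  obtain ⟨i, j, -, hk⟩ := T.exists_tiles_of_edge he
  obtain ⟨α, β, hg, rfl⟩ := exists_isGap_of_edge he ((hk i).mpr (Or.inl rfl))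
  rw [hg.closure_edge] at hq
  obtain ⟨t, ht, rfl⟩ := hq
  refine ⟨t, ⟨lt_of_le_of_ne ht.1 ?_, lt_of_le_of_ne ht.2 ?_⟩, rfl⟩
  · rintro rfl
    have := hg.left.2
    omega
  · rintro rfl
    have := hg.right.2
    omega

variable (T)

/-- Every edge has exactly two end points, which are vertices. -/
theorem exists_ends_of_edge {e : Set Plane} (he : e ∈ T.edges) :
    ∃ a b, a ≠ b ∧ ∀ v, (3 ≤ T.valence v ∧ v ∈ closure e) ↔ v = a ∨ v = b := by
  obtain ⟨i, j, -, hk⟩ := T.exists_tiles_of_edge he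
  obtain ⟨α, β, hg, rfl⟩ := exists_isGap_of_edge he ((hk i).mpr (Or.inl rfl))
  refine ⟨T.curve i α, T.curve i β, T.curve_ne_of_lt hg.lt hg.lt_two_pi,
    fun v => ⟨fun h => ?_, fun h => ?_⟩⟩
  · exact (hg.mem_closure_iff h.1).mp h.2
  · have hv : 3 ≤ T.valence v := by
      rcases h with rfl | rfl
      · exact hg.left.2
      · exact hg.right.2
    exact ⟨hv, (hg.mem_closure_iff hv).mpr h⟩

/-- Exactly two edges of a tile end at each of its vertices. -/
theorem exists_edges_of_vertex {i : ι} {v : Plane} (hv : v ∈ T.vertices i) :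
    ∃ e e', e ≠ e' ∧ ∀ f, (f ∈ T.edges ∧ f ⊆ T.tile i ∧ v ∈ closure f) ↔ f = e ∨ f = e' := by
  have hvb : v ∈ T.boundary i :=
    (T.mem_boundary_iff hv.1).mpr ((Nat.le_succ 2).trans hv.2)
  obtain ⟨θ, -, rfl⟩ := T.exists_curve_eq hvb 0
  obtain ⟨α, hα⟩ := T.exists_isGap_left hv
  obtain ⟨β, hβ⟩ := T.exists_isGap_right hv
  refine ⟨T.curve i '' Set.Ioo α θ, T.curve i '' Set.Ioo θ β, ?_, fun f => ⟨?_, ?_⟩⟩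
  · intro heq
    obtain ⟨s, hs⟩ := Set.nonempty_Ioo.mpr hα.lt
    have h1 : T.curve i s ∈ T.curve i '' Set.Ioo θ β := heq ▸ ⟨s, hs, rfl⟩
    obtain ⟨t, ht, hts⟩ := h1
    -- The vertex at `α` recurs one turn later, so the gap after `θ` ends there at the latest and
    -- its arc cannot repeat the one before `θ`.
    have hβα : β ≤ α + 2 * Real.pi := by
      by_contra! hlt
      refine hβ.between (α + 2 * Real.pi) ⟨hα.lt_two_pi, hlt⟩ ?_
      rw [T.curve_add_two_pi]
      exact hα.left
    exact T.curve_ne_of_lt (hs.2.trans ht.1) (by linarith [hs.1, ht.2]) hts.symm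
  · rintro ⟨hf, hfi, hcl⟩
    obtain ⟨a, b, hg, rfl⟩ := exists_isGap_of_edge hf hfi
    rcases (hg.mem_closure_iff hv.2).mp hcl with h | h
    · right
      obtain ⟨m, hm⟩ := T.curve_eq_iff.mp h
      -- A step this small past the vertex lands, modulo full turns, inside both arcs, so they are
      -- the same edge.
      set δ := min (β - θ) (b - a) / 2 with hδ
      have h1 : 0 < min (β - θ) (b - a) := lt_min (sub_pos.mpr hβ.lt) (sub_pos.mpr hg.lt)
      have h2 := min_le_left (β - θ) (b - a)
      have h3 := min_le_right (β - θ) (b - a)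
      have h4 : T.curve i (θ + δ) = T.curve i (a + δ) :=
        T.curve_eq_iff.mpr ⟨m, by rw [hm]; ring⟩
      exact hβ.eq_edge hf (θ := θ + δ) ⟨by linarith, by linarith⟩
        (h4 ▸ ⟨a + δ, ⟨by linarith, by linarith⟩, rfl⟩)
    · left
      obtain ⟨m, hm⟩ := T.curve_eq_iff.mp h
      set δ := min (θ - α) (b - a) / 2 with hδ
      have h1 : 0 < min (θ - α) (b - a) := lt_min (sub_pos.mpr hα.lt) (sub_pos.mpr hg.lt)
      have h2 := min_le_left (θ - α) (b - a)
      have h3 := min_le_right (θ - α) (b - a)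
      have h4 : T.curve i (θ - δ) = T.curve i (b - δ) :=
        T.curve_eq_iff.mpr ⟨m, by rw [hm]; ring⟩
      exact hα.eq_edge hf (θ := θ - δ) ⟨by linarith, by linarith⟩
        (h4 ▸ ⟨b - δ, ⟨by linarith, by linarith⟩, rfl⟩)
  · rintro (rfl | rfl)
    · exact ⟨hα.edge_mem, IsGap.edge_subset, (hα.mem_closure_iff hv.2).mpr (Or.inr rfl)⟩
    · exact ⟨hβ.edge_mem, IsGap.edge_subset, (hβ.mem_closure_iff hv.2).mpr (Or.inl rfl)⟩

/-! ### The tessellation near a point -/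

theorem finite_edges_of_tile (i : ι) : {e | e ∈ T.edges ∧ e ⊆ T.tile i}.Finite := by
  have h1 : ∀ v ∈ T.vertices i, {f | f ∈ T.edges ∧ f ⊆ T.tile i ∧ v ∈ closure f}.Finite := by
    intro v hv
    obtain ⟨e, e', -, h⟩ := T.exists_edges_of_vertex hv
    apply (Set.toFinite {e, e'}).subset
    intro f hf
    exact (h f).mp hf
  apply ((T.vertices_finite i).biUnion h1).subset
  rintro e ⟨he, hi⟩
  obtain ⟨a, b, -, hab⟩ := T.exists_ends_of_edge he
  have ha := (hab a).mpr (Or.inl rfl)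
  exact Set.mem_biUnion (x := a) ⟨T.closure_edge_subset hi ha.2, ha.1⟩ ⟨he, hi, ha.2⟩

/-- Edges through points near `p` belong to tiles at `p`. There are finitely many of these edges, so
one can stay clear of those whose closure misses `p`. -/
theorem eventually_mem_closure_edge (p : Plane) :
    ∀ᶠ q in 𝓝 p, ∀ e ∈ T.edges, q ∈ e → p ∈ closure e := by
  have hfin : (⋃ i ∈ T.tilesAt p, {e | e ∈ T.edges ∧ e ⊆ T.tile i}).Finite :=
    (T.finite_tilesAt p).biUnion fun i _ => T.finite_edges_of_tile i
  have h1 : ∀ᶠ q in 𝓝 p, ∀ e ∈ ⋃ i ∈ T.tilesAt p, {e | e ∈ T.edges ∧ e ⊆ T.tile i},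
      q ∈ e → p ∈ closure e := by
    rw [Filter.eventually_all_finite hfin]
    intro e _
    by_cases hp : p ∈ closure e
    · exact Filter.Eventually.of_forall fun _ _ => hp
    · filter_upwards [isClosed_closure.isOpen_compl.mem_nhds hp] with q hq hqe
      exact absurd (subset_closure hqe) hq
  filter_upwards [h1, T.eventually_tilesAt_subset p] with q h2 h3 e he hqe
  obtain ⟨i, hi⟩ := T.exists_mem_tile q
  exact h2 e (Set.mem_biUnion (h3 hi) ⟨he, (T.edge_subset_iff he hqe).mpr hi⟩) hqe

theorem eventually_valence_le_two (p : Plane) :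
    ∀ᶠ q in 𝓝 p, q ≠ p → T.valence q ≤ 2 := by
  have hfin : (⋃ i ∈ T.tilesAt p, T.vertices i).Finite :=
    (T.finite_tilesAt p).biUnion fun i _ => T.vertices_finite i
  have hcl : IsClosed ((⋃ i ∈ T.tilesAt p, T.vertices i) \ {p}) := (hfin.sdiff).isClosed
  filter_upwards [hcl.isOpen_compl.mem_nhds (by simp), T.eventually_tilesAt_subset p]
    with q h1 h2 hne
  by_contra! h3
  obtain ⟨i, hi⟩ := T.exists_mem_tile q
  exact h1 ⟨Set.mem_biUnion (h2 hi) ⟨hi, h3⟩, hne⟩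

/-- The tiles at a point are connected with each other through the edges that end there. -/
theorem iff_of_forall_edge (p : Plane) (S : ι → Prop)
    (hS : ∀ e ∈ T.edges, p ∈ closure e → ∀ i j, e ⊆ T.tile i → e ⊆ T.tile j → (S i ↔ S j))
    {i j : ι} (hi : p ∈ T.tile i) (hj : p ∈ T.tile j) : S i ↔ S j := by
  suffices ∀ i j, p ∈ T.tile i → p ∈ T.tile j → S i → S j from ⟨this i j hi hj, this j i hj hi⟩
  clear hi hj i j
  intro i j hi hj hSi
  by_contra hSj
  obtain ⟨ε, hε, hB⟩ := Metric.eventually_nhds_iff_ball.mp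
    ((T.eventually_tilesAt_subset p).and ((T.eventually_mem_closure_edge p).and
      (T.eventually_valence_le_two p)))
  have hclosed : ∀ P : ι → Prop, IsClosed (⋃ k ∈ {k | k ∈ T.tilesAt p ∧ P k}, T.tile k) :=
    fun P => ((T.finite_tilesAt p).subset fun k hk => hk.1).isClosed_biUnion
      fun k _ => T.isClosed_tile k
  have hne : ∀ k, p ∈ T.tile k → ((Metric.ball p ε \ {p}) ∩ T.tile k).Nonempty := by
    intro k hk
    have h1 := (T.isConnected_tile k).isPreconnected.preperfect_of_nontrivial
      (T.nontrivial_tile k) p hk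
    rw [accPt_iff_nhds] at h1
    obtain ⟨y, ⟨hy1, hy2⟩, hy3⟩ := h1 _ (Metric.ball_mem_nhds p hε)
    exact ⟨y, ⟨hy1, hy3⟩, hy2⟩
  have hcov : Metric.ball p ε \ {p} ⊆ (⋃ k ∈ {k | k ∈ T.tilesAt p ∧ S k}, T.tile k) ∪
      ⋃ k ∈ {k | k ∈ T.tilesAt p ∧ ¬ S k}, T.tile k := by
    rintro q ⟨hqB, -⟩
    obtain ⟨k, hk⟩ := T.exists_mem_tile q
    have hkp := (hB q hqB).1 hk
    by_cases hSk : S k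
    · exact Or.inl (Set.mem_biUnion (x := k) ⟨hkp, hSk⟩ hk)
    · exact Or.inr (Set.mem_biUnion (x := k) ⟨hkp, hSk⟩ hk)
  -- Tiles with and without the property would cover the connected punctured disk by two closed
  -- sets. They meet at some `q ≠ p`, of valence two, hence on an edge ending at `p`, across which
  -- the property is preserved.
  obtain ⟨q, ⟨hqB, hqp⟩, hq1, hq2⟩ := isPreconnected_closed_iff.mp
    (isPreconnected_ball_diff_center p hε) _ _ (hclosed S) (hclosed fun k => ¬ S k) hcov
    ((hne i hi).mono fun q hq => ⟨hq.1, Set.mem_biUnion (x := i) ⟨hi, hSi⟩ hq.2⟩)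
    ((hne j hj).mono fun q hq => ⟨hq.1, Set.mem_biUnion (x := j) ⟨hj, hSj⟩ hq.2⟩)
  obtain ⟨k, hk, hqk⟩ := Set.mem_iUnion₂.mp hq1
  obtain ⟨l, hl, hql⟩ := Set.mem_iUnion₂.mp hq2
  have hkl : k ≠ l := by
    rintro rfl
    exact hl.2 hk.2
  have h2 : T.valence q = 2 :=
    le_antisymm ((hB q hqB).2.2 hqp) (T.two_le_valence_iff.mpr ⟨k, l, hkl, hqk, hql⟩)
  obtain ⟨e, he, hqe⟩ := T.exists_edge_mem h2
  exact hl.2 ((hS e he ((hB q hqB).2.1 e he hqe) k l ((T.edge_subset_iff he hqe).mpr hqk)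
    ((T.edge_subset_iff he hqe).mpr hql)).mp hk.2)

end Tessellation

/-! ### Incidence matrices modulo two -/

theorem sum_subtype_ite_mul {X : Type*} (s : Set X) [Fintype s] (P : X → Prop) [DecidablePred P]
    (φ : X → ZMod 2) {a b : X} (hab : a ≠ b) (hP : ∀ x ∈ s, (P x ↔ x = a ∨ x = b))
    (ha : a ∉ s → φ a = 0) (hb : b ∉ s → φ b = 0) :
    ∑ x : s, (if P x then 1 else 0) * φ x = φ a + φ b := by
  rw [← finsum_eq_sum_of_fintype,
    finsum_set_coe_eq_finsum_mem (f := fun x => (if P x then 1 else 0) * φ x) s,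
    ← finsum_mem_pair hab, finsum_mem_def, finsum_mem_def]
  congr 1
  funext x
  by_cases hx : x ∈ s
  · rw [Set.indicator_of_mem hx]
    by_cases h : x ∈ ({a, b} : Set X)
    · rw [Set.indicator_of_mem h, if_pos ((hP x hx).mpr h), one_mul]
    · rw [Set.indicator_of_notMem h, if_neg (mt (hP x hx).mp h), zero_mul]
  · rw [Set.indicator_of_notMem hx]
    by_cases h : x ∈ ({a, b} : Set X)
    · rw [Set.indicator_of_mem h]
      rcases h with rfl | rfl
      · exact (ha hx).symm
      · exact (hb hx).symm
    · rw [Set.indicator_of_notMem h]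

theorem sum_ite_mul {X : Type*} [Fintype X] (P : X → Prop) [DecidablePred P]
    (φ : X → ZMod 2) {a b : X} (hab : a ≠ b) (hP : ∀ x, P x ↔ x = a ∨ x = b) :
    ∑ x, (if P x then 1 else 0) * φ x = φ a + φ b := by
  classical
  have h1 : Finset.univ.filter P = {a, b} := by
    ext x
    simp [hP]
  simp only [ite_mul, one_mul, zero_mul]
  rw [← Finset.sum_filter, h1, Finset.sum_pair hab]

/-- The incidence matrix modulo two of a relation. -/
def incidence {A B : Type*} (r : A → B → Prop) [∀ a b, Decidable (r a b)] :
    Matrix A B (ZMod 2) :=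
  Matrix.of fun a b => if r a b then 1 else 0

theorem ZMod.two_sub_eq_add (a b : ZMod 2) : a - b = a + b := by
  revert a b
  decide

theorem ZMod.two_add_eq_zero_iff {a b : ZMod 2} : a + b = 0 ↔ a = b := by
  rw [← ZMod.two_sub_eq_add, sub_eq_zero]

/-- If a relation between two finite types has exactly two entries in each row and each column
and is connected, then a vector with vanishing sum is a coboundary. -/
theorem exists_potential_of_sum_eq_zero {L I : Type*} [Fintype L] [Fintype I]
    (r : L → I → Prop)
    (hL : ∀ l, ∃ a b, a ≠ b ∧ ∀ k, r l k ↔ k = a ∨ k = b)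
    (hI : ∀ i, ∃ e e', e ≠ e' ∧ ∀ l, r l i ↔ l = e ∨ l = e')
    (hconn : ∀ h : I → ZMod 2, (∀ l a b, r l a → r l b → h a = h b) → ∀ a b, h a = h b)
    (g : L → ZMod 2) (hg : ∑ l, g l = 0) :
    ∃ h : I → ZMod 2, ∀ l a b, a ≠ b → r l a → r l b → h a - h b = g l := by
  classical
  rcases isEmpty_or_nonempty L with hE | ⟨⟨l₀⟩⟩
  · exact ⟨0, fun l => (hE.false l).elim⟩
  obtain ⟨i₀, -⟩ := hL l₀
  have hcard : Fintype.card L = Fintype.card I := by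
    have h1 := Finset.sum_card_bipartiteAbove_eq_sum_card_bipartiteBelow r
      (s := (Finset.univ : Finset L)) (t := (Finset.univ : Finset I))
    have h2 : ∀ l ∈ (Finset.univ : Finset L),
        (Finset.bipartiteAbove r Finset.univ l).card = 2 := by
      intro l _
      obtain ⟨a, b, hab, h⟩ := hL l
      rw [← Finset.card_pair hab]
      congr 1
      ext k
      simp [Finset.bipartiteAbove, h]
    have h3 : ∀ i ∈ (Finset.univ : Finset I),
        (Finset.bipartiteBelow r Finset.univ i).card = 2 := by
      intro i _
      obtain ⟨a, b, hab, h⟩ := hI i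
      rw [← Finset.card_pair hab]
      congr 1
      ext k
      simp [Finset.bipartiteBelow, h]
    rw [Finset.sum_congr rfl h2, Finset.sum_congr rfl h3] at h1
    simpa using h1
  let δ := (incidence r).mulVecLin
  have hδ : ∀ h l a b, a ≠ b → r l a → r l b → δ h l = h a + h b := by
    intro h l a b hab ha hb
    obtain ⟨a', b', hab', h'⟩ := hL l
    have hr : ∀ k, r l k ↔ k = a ∨ k = b := by
      intro k
      rw [h'] at ha hb ⊢
      rcases ha with rfl | rfl <;> rcases hb with rfl | rfl
      · exact absurd rfl hab
      · rfl
      · exact or_comm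
      · exact absurd rfl hab
    exact sum_ite_mul (r l) h hab hr
  -- By connectedness a function killed by `δ` is determined by its value at `i₀`.
  have hker : Module.finrank (ZMod 2) (LinearMap.ker δ) ≤ 1 := by
    have hinj : Function.Injective ((LinearMap.proj (R := ZMod 2)
        (φ := fun _ : I => ZMod 2) i₀).comp
        (LinearMap.ker δ).subtype) := by
      rw [← LinearMap.ker_eq_bot, LinearMap.ker_eq_bot']
      rintro ⟨h, hh⟩ h0
      have h1 : h i₀ = 0 := h0
      apply Subtype.ext
      funext i
      change h i = 0
      rw [← h1]
      apply hconn
      intro l a b ha hb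
      rcases eq_or_ne a b with rfl | hab
      · rfl
      rw [← ZMod.two_add_eq_zero_iff, ← hδ h l a b hab ha hb, LinearMap.mem_ker.mp hh]
      rfl
    have := LinearMap.finrank_le_finrank_of_injective hinj
    rwa [Module.finrank_self] at this
  let σ : (L → ZMod 2) →ₗ[ZMod 2] ZMod 2 := ∑ l, LinearMap.proj l
  have hσ : ∀ g, σ g = ∑ l, g l := fun g => by simp [σ]
  have hσs : Function.Surjective σ := by
    intro c
    refine ⟨Pi.single l₀ c, ?_⟩
    rw [hσ]
    simp
  have hle : LinearMap.range δ ≤ LinearMap.ker σ := by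
    rintro _ ⟨h, rfl⟩
    rw [LinearMap.mem_ker, hσ]
    change ∑ l, ∑ i, (if r l i then 1 else 0) * h i = 0
    rw [Finset.sum_comm]
    apply Finset.sum_eq_zero
    intro i _
    obtain ⟨e, e', hne, he⟩ := hI i
    rw [sum_ite_mul (fun l => r l i) (fun _ => h i) hne he]
    exact ZMod.two_add_eq_zero_iff.mpr rfl
  -- The relation has as many rows as columns, so `δ` has rank at least that number minus one, which
  -- is the dimension of the hyperplane of vanishing sum.
  have heq : LinearMap.range δ = LinearMap.ker σ := by
    apply Submodule.eq_of_le_of_finrank_le hle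
    have h1 := LinearMap.finrank_range_add_finrank_ker δ
    have h2 := LinearMap.finrank_range_add_finrank_ker σ
    rw [LinearMap.range_eq_top.mpr hσs, finrank_top, Module.finrank_self,
      Module.finrank_fintype_fun_eq_card] at h2
    rw [Module.finrank_fintype_fun_eq_card] at h1
    omega
  obtain ⟨h, hh⟩ : g ∈ LinearMap.range δ := by
    rw [heq, LinearMap.mem_ker, hσ, hg]
  refine ⟨h, fun l a b hab ha hb => ?_⟩
  rw [← hh, hδ h l a b hab ha hb, ZMod.two_sub_eq_add]

/-! ### Potentials and connectedness on a tessellation -/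

namespace Tessellation

variable {ι : Type*} (T : Tessellation ι)

theorem finite_edges_at (p : Plane) : {e | e ∈ T.edges ∧ p ∈ closure e}.Finite := by
  apply ((T.finite_tilesAt p).biUnion fun i _ => T.finite_edges_of_tile i).subset
  rintro e ⟨he, hp⟩
  obtain ⟨i, j, -, hk⟩ := T.exists_tiles_of_edge he
  have hi := (hk i).mpr (Or.inl rfl)
  exact Set.mem_biUnion (x := i) (T.closure_edge_subset hi hp) ⟨he, hi⟩

/-- A labelling of the edges modulo two with vanishing sum at each vertex is near every point the
difference of a labelling of the tiles. -/
theorem exists_local_labelling (G : Set Plane → ZMod 2)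
    (hG : ∀ v, 3 ≤ T.valence v → ∑ᶠ e ∈ {e | e ∈ T.edges ∧ v ∈ closure e}, G e = 0) (p : Plane) :
    ∃ h : ι → ZMod 2, ∀ e ∈ T.edges, p ∈ closure e → ∀ i j, i ≠ j → e ⊆ T.tile i → e ⊆ T.tile j →
      h i - h j = G e := by
  classical
  by_cases hv : 3 ≤ T.valence p
  · have := (T.finite_edges_at p).fintype
    have := (T.finite_tilesAt p).fintype
    have hL : ∀ e : {e | e ∈ T.edges ∧ p ∈ closure e}, ∃ a b : T.tilesAt p, a ≠ b ∧
        ∀ k : T.tilesAt p, (e : Set Plane) ⊆ T.tile k ↔ k = a ∨ k = b := by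
      rintro ⟨e, he, hp⟩
      obtain ⟨i, j, hij, hk⟩ := T.exists_tiles_of_edge he
      refine ⟨⟨i, T.closure_edge_subset ((hk i).mpr (Or.inl rfl)) hp⟩,
        ⟨j, T.closure_edge_subset ((hk j).mpr (Or.inr rfl)) hp⟩,
        fun h => hij (congrArg Subtype.val h), fun k => ?_⟩
      rw [hk k, Subtype.ext_iff, Subtype.ext_iff]
    have hI : ∀ i : T.tilesAt p, ∃ a b : {e | e ∈ T.edges ∧ p ∈ closure e}, a ≠ b ∧
        ∀ e : {e | e ∈ T.edges ∧ p ∈ closure e}, (e : Set Plane) ⊆ T.tile i ↔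
          e = a ∨ e = b := by
      rintro ⟨i, hi⟩
      obtain ⟨e, e', hne, hf⟩ := T.exists_edges_of_vertex (i := i) (v := p) ⟨hi, hv⟩
      have he := (hf e).mpr (Or.inl rfl)
      have he' := (hf e').mpr (Or.inr rfl)
      refine ⟨⟨e, he.1, he.2.2⟩, ⟨e', he'.1, he'.2.2⟩,
        fun h => hne (congrArg Subtype.val h), fun l => ?_⟩
      rw [Subtype.ext_iff, Subtype.ext_iff, ← hf]
      exact ⟨fun h => ⟨l.2.1, h, l.2.2⟩, fun h => h.2.1⟩
    have hconn : ∀ h : T.tilesAt p → ZMod 2,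
        (∀ (e : {e | e ∈ T.edges ∧ p ∈ closure e}) (a b : T.tilesAt p),
          (e : Set Plane) ⊆ T.tile a → (e : Set Plane) ⊆ T.tile b → h a = h b) →
        ∀ a b, h a = h b := by
      intro h hh a b
      -- The membership proof is part of the propagated property because `h` is defined only on
      -- tiles at `p`.
      refine ((T.iff_of_forall_edge p (fun k => ∃ hk : k ∈ T.tilesAt p, h ⟨k, hk⟩ = h b)
        ?_ a.2 b.2).mpr ⟨b.2, rfl⟩).2
      intro e he hp i j hi hj
      have hi' : i ∈ T.tilesAt p := T.closure_edge_subset hi hp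
      have hj' : j ∈ T.tilesAt p := T.closure_edge_subset hj hp
      have := hh ⟨e, he, hp⟩ ⟨i, hi'⟩ ⟨j, hj'⟩ hi hj
      constructor
      · rintro ⟨_, h1⟩
        exact ⟨hj', this.symm.trans h1⟩
      · rintro ⟨_, h1⟩
        exact ⟨hi', this.trans h1⟩
    have hsum : ∑ e : {e | e ∈ T.edges ∧ p ∈ closure e}, G e = 0 := by
      rw [← finsum_eq_sum_of_fintype, finsum_set_coe_eq_finsum_mem (f := G)]
      exact hG p hv
    obtain ⟨h, hh⟩ := exists_potential_of_sum_eq_zero _ hL hI hconn _ hsum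
    refine ⟨fun i => if hi : i ∈ T.tilesAt p then h ⟨i, hi⟩ else 0, ?_⟩
    intro e he hp i j hij hi hj
    have hi' : i ∈ T.tilesAt p := T.closure_edge_subset hi hp
    have hj' : j ∈ T.tilesAt p := T.closure_edge_subset hj hp
    simp only [dif_pos hi', dif_pos hj']
    exact hh ⟨e, he, hp⟩ ⟨i, hi'⟩ ⟨j, hj'⟩ (fun h => hij (congrArg Subtype.val h)) hi hj
  · by_cases hex : ∃ e ∈ T.edges, p ∈ closure e
    · obtain ⟨e, he, hpe⟩ := hex
      obtain ⟨a, b, hab, hk⟩ := T.exists_tiles_of_edge he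
      -- Below valence three, `e` is the only edge with `p` in its closure; modulo two the
      -- orientation of the difference is irrelevant.
      refine ⟨fun k => if k = a then 0 else G e, ?_⟩
      intro f hf hpf i j hij hi hj
      have hef : f = e := T.edge_eq_of_mem hf he (mem_edge_of_mem_closure hf hpf (by omega))
        (mem_edge_of_mem_closure he hpe (by omega))
      subst hef
      rw [hk] at hi hj
      rcases hi with rfl | rfl <;> rcases hj with rfl | rfl
      · exact absurd rfl hij
      · simp [hab.symm]
      · simp [hab.symm]
      · exact absurd rfl hij
    · exact ⟨0, fun e he hp => absurd ⟨e, he, hp⟩ hex⟩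

/-- A labelling of the edges modulo two with vanishing sum at each vertex is the difference of a
labelling of the tiles. -/
theorem exists_potential (G : Set Plane → ZMod 2)
    (hG : ∀ v, 3 ≤ T.valence v → ∑ᶠ e ∈ {e | e ∈ T.edges ∧ v ∈ closure e}, G e = 0) :
    ∃ f : ι → ZMod 2, ∀ e ∈ T.edges, ∀ i j, i ≠ j → e ⊆ T.tile i → e ⊆ T.tile j →
      f i - f j = G e := by
  choose h hh using T.exists_local_labelling G hG
  have hloc : ∀ p, ∀ᶠ q in 𝓝 p, ∀ i j, q ∈ T.tile i → q ∈ T.tile j →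
      h q i - h q j = h p i - h p j := by
    intro p
    filter_upwards [T.eventually_valence_le_two p, T.eventually_mem_closure_edge p]
      with q h1 h2 i j hi hj
    rcases eq_or_ne i j with rfl | hij
    · simp
    rcases eq_or_ne q p with rfl | hqp
    · rfl
    have hv : T.valence q = 2 :=
      le_antisymm (h1 hqp) (T.two_le_valence_iff.mpr ⟨i, j, hij, hi, hj⟩)
    obtain ⟨e, he, hqe⟩ := T.exists_edge_mem hv
    have hei := (T.edge_subset_iff he hqe).mpr hi
    have hej := (T.edge_subset_iff he hqe).mpr hj
    rw [hh q e he (subset_closure hqe) i j hij hei hej, hh p e he (h2 e he hqe) i j hij hei hej]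
  obtain ⟨f, hf⟩ := exists_global_labelling T.tile T.isClosed_tile
    (fun i => (T.isConnected_tile i).isPreconnected) T.exists_mem_tile T.locallyFinite h hloc
  refine ⟨f, fun e he i j hij hi hj => ?_⟩
  obtain ⟨q, hq⟩ := T.edge_nonempty he
  rw [← hf q i j (hi hq) (hj hq)]
  exact hh q e he (subset_closure hq) i j hij hi hj

/-- A function on the tiles that is constant across all edges is constant. -/
theorem eq_of_forall_edge {β : Type*} (f : ι → β)
    (hf : ∀ e ∈ T.edges, ∀ i j, e ⊆ T.tile i → e ⊆ T.tile j → f i = f j) (i j : ι) :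
    f i = f j := by
  have hloc : ∀ p i j, p ∈ T.tile i → p ∈ T.tile j → f i = f j := by
    intro p i j hi hj
    refine (T.iff_of_forall_edge p (fun k => f k = f j) ?_ hi hj).mpr rfl
    intro e he _ a b ha hb
    rw [hf e he a b ha hb]
  choose c hc using T.exists_mem_tile
  have hconst : ∀ p q, f (c p) = f (c q) := by
    intro p q
    refine isPreconnected_univ.induction₂ (fun x y => f (c x) = f (c y)) ?_ ?_ ?_
      (Set.mem_univ p) (Set.mem_univ q)
    · intro x _
      filter_upwards [mem_nhdsWithin_of_mem_nhds (T.eventually_tilesAt_subset x)] with y hy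
      exact hloc x _ _ (hc x) (hy (hc y))
    · intro x y z _ _ _ h1 h2
      exact h1.trans h2
    · intro x y _ _ h
      exact h.symm
  obtain ⟨p, hp⟩ := (T.isConnected_tile i).nonempty
  obtain ⟨q, hq⟩ := (T.isConnected_tile j).nonempty
  rw [hloc p i _ hp (hc p), hloc q j _ hq (hc q), hconst p q]

theorem isPreconnected_boundary (i : ι) : IsPreconnected (T.boundary i) := by
  have : T.boundary i = T.curve i '' Set.univ := by
    apply Set.Subset.antisymm
    · intro p hp
      obtain ⟨θ, -, rfl⟩ := T.exists_curve_eq hp 0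
      exact ⟨θ, trivial, rfl⟩
    · rintro _ ⟨θ, -, rfl⟩
      exact T.curve_mem_boundary i θ
  rw [this]
  exact isPreconnected_univ.image _ (T.continuous_curve i).continuousOn

/-- A function on the vertices of a tile that is constant along its edges is constant. -/
theorem eq_of_forall_edge_of_tile {β : Type*} (φ : Plane → β) (i : ι)
    (hφ : ∀ e ∈ T.edges, e ⊆ T.tile i → ∀ a ∈ closure e, ∀ b ∈ closure e,
      3 ≤ T.valence a → 3 ≤ T.valence b → φ a = φ b)
    {v w : Plane} (hv : v ∈ T.vertices i) (hw : w ∈ T.vertices i) : φ v = φ w := by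
  by_contra hne
  -- Edges satisfying `Q` and edges violating it would cover the connected boundary curve by two
  -- closed sets. At a common point `φ` carries `Q` over, or the two edges coincide.
  let Q : Set Plane → Prop := fun e => ∀ a ∈ closure e, 3 ≤ T.valence a → φ v = φ a
  have hcl : ∀ P : Set Plane → Prop,
      IsClosed (⋃ e ∈ {e | (e ∈ T.edges ∧ e ⊆ T.tile i) ∧ P e}, closure e) := fun P =>
    ((T.finite_edges_of_tile i).subset fun e he => he.1).isClosed_biUnion
      fun e _ => isClosed_closure
  have hb : ∀ u ∈ T.vertices i, u ∈ T.boundary i ∧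
      ∃ e ∈ T.edges, e ⊆ T.tile i ∧ u ∈ closure e := by
    intro u hu
    obtain ⟨e, e', -, h⟩ := T.exists_edges_of_vertex hu
    exact ⟨(T.mem_boundary_iff hu.1).mpr ((Nat.le_succ 2).trans hu.2), e, (h e).mpr (Or.inl rfl)⟩
  have hcov : T.boundary i ⊆ (⋃ e ∈ {e | (e ∈ T.edges ∧ e ⊆ T.tile i) ∧ Q e}, closure e) ∪
      ⋃ e ∈ {e | (e ∈ T.edges ∧ e ⊆ T.tile i) ∧ ¬ Q e}, closure e := by
    intro q hq
    have hqi := T.boundary_subset_tile i hq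
    obtain ⟨e, he, hei, hqe⟩ : ∃ e ∈ T.edges, e ⊆ T.tile i ∧ q ∈ closure e := by
      by_cases h3 : 3 ≤ T.valence q
      · exact (hb q ⟨hqi, h3⟩).2
      · have h2 := (T.mem_boundary_iff hqi).mp hq
        obtain ⟨e, he, hqe⟩ := T.exists_edge_mem (q := q) (by omega)
        exact ⟨e, he, (T.edge_subset_iff he hqe).mpr hqi, subset_closure hqe⟩
    by_cases hQ : Q e
    · exact Or.inl (Set.mem_biUnion (x := e) ⟨⟨he, hei⟩, hQ⟩ hqe)
    · exact Or.inr (Set.mem_biUnion (x := e) ⟨⟨he, hei⟩, hQ⟩ hqe)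
  obtain ⟨hvb, e, he, hei, hve⟩ := hb v hv
  obtain ⟨hwb, e', he', hei', hwe'⟩ := hb w hw
  obtain ⟨q, -, hq1, hq2⟩ := isPreconnected_closed_iff.mp (T.isPreconnected_boundary i) _ _
    (hcl Q) (hcl fun e => ¬ Q e) hcov
    ⟨v, hvb, Set.mem_biUnion (x := e) ⟨⟨he, hei⟩, fun a ha h3 =>
      hφ e he hei v hve a ha hv.2 h3⟩ hve⟩
    ⟨w, hwb, Set.mem_biUnion (x := e') ⟨⟨he', hei'⟩, fun hQ => hne (hQ w hwe' hw.2)⟩ hwe'⟩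
  obtain ⟨k, ⟨⟨hk, hki⟩, hQk⟩, hqk⟩ := Set.mem_iUnion₂.mp hq1
  obtain ⟨l, ⟨⟨hl, hli⟩, hQl⟩, hql⟩ := Set.mem_iUnion₂.mp hq2
  by_cases h3 : 3 ≤ T.valence q
  · exact hQl fun a ha h3a => (hQk q hqk h3).trans (hφ l hl hli q hql a ha h3 h3a)
  · have hkl : k = l := T.edge_eq_of_mem hk hl (mem_edge_of_mem_closure hk hqk (by omega))
      (mem_edge_of_mem_closure hl hql (by omega))
    exact hQl (hkl ▸ hQk)

/-- A function on the vertices of the tiles that meet a disk is constant if it is constant along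
the edges of these tiles. -/
theorem eq_of_forall_edge_of_configuration {β : Type*} (φ : Plane → β) (x : Plane) (r : ℝ)
    (hφ : ∀ e ∈ T.edges, ∀ i ∈ T.configuration x r, e ⊆ T.tile i → ∀ a ∈ closure e,
      ∀ b ∈ closure e, 3 ≤ T.valence a → 3 ≤ T.valence b → φ a = φ b)
    {i j : ι} (hi : i ∈ T.configuration x r) (hj : j ∈ T.configuration x r)
    {v w : Plane} (hv : v ∈ T.vertices i) (hw : w ∈ T.vertices j) : φ v = φ w := by
  by_contra hne
  have htile : ∀ k ∈ T.configuration x r, ∀ a ∈ T.vertices k, ∀ b ∈ T.vertices k, φ a = φ b :=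
    fun k hk a ha b hb =>
      T.eq_of_forall_edge_of_tile φ k (fun e he hek => hφ e he k hk hek) ha hb
  let Q : ι → Prop := fun k => ∀ a ∈ T.vertices k, φ v = φ a
  have hcl : ∀ P : ι → Prop,
      IsClosed (⋃ k ∈ {k | k ∈ T.configuration x r ∧ P k}, T.tile k) := fun P =>
    ((T.configuration_finite x r).subset fun k hk => hk.1).isClosed_biUnion
      fun k _ => T.isClosed_tile k
  have hcov : Metric.closedBall x r ⊆ (⋃ k ∈ {k | k ∈ T.configuration x r ∧ Q k}, T.tile k) ∪
      ⋃ k ∈ {k | k ∈ T.configuration x r ∧ ¬ Q k}, T.tile k := by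
    intro q hq
    obtain ⟨k, hk⟩ := T.exists_mem_tile q
    have hkC : k ∈ T.configuration x r := ⟨q, hk, hq⟩
    by_cases hQ : Q k
    · exact Or.inl (Set.mem_biUnion (x := k) ⟨hkC, hQ⟩ hk)
    · exact Or.inr (Set.mem_biUnion (x := k) ⟨hkC, hQ⟩ hk)
  have hi' := hi
  have hj' := hj
  obtain ⟨p, hp, hpB⟩ := hi'
  obtain ⟨p', hp', hpB'⟩ := hj'
  obtain ⟨q, -, hq1, hq2⟩ := isPreconnected_closed_iff.mp
    (Metric.isPreconnected_closedBall (x := x) (r := r)) _ _ (hcl Q) (hcl fun k => ¬ Q k) hcov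
    ⟨p, hpB, Set.mem_biUnion (x := i) ⟨hi, fun a ha => htile i hi v hv a ha⟩ hp⟩
    ⟨p', hpB', Set.mem_biUnion (x := j) ⟨hj, fun hQ => hne (hQ w hw)⟩ hp'⟩
  obtain ⟨k, ⟨hk, hQk⟩, hqk⟩ := Set.mem_iUnion₂.mp hq1
  obtain ⟨l, ⟨hl, hQl⟩, hql⟩ := Set.mem_iUnion₂.mp hq2
  obtain ⟨a, hak, hal⟩ : ∃ a, a ∈ T.vertices k ∧ a ∈ T.vertices l := by
    by_cases h3 : 3 ≤ T.valence q
    · exact ⟨q, ⟨hqk, h3⟩, hql, h3⟩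
    · have hkl : k ≠ l := by
        rintro rfl
        exact hQl hQk
      have h2 := T.two_le_valence_iff.mpr ⟨k, l, hkl, hqk, hql⟩
      obtain ⟨e, he, hqe⟩ := T.exists_edge_mem (q := q) (by omega)
      obtain ⟨a, b, -, hab⟩ := T.exists_ends_of_edge he
      have ha := (hab a).mpr (Or.inl rfl)
      exact ⟨a, ⟨T.closure_edge_subset ((T.edge_subset_iff he hqe).mpr hqk) ha.2, ha.1⟩,
        T.closure_edge_subset ((T.edge_subset_iff he hqe).mpr hql) ha.2, ha.1⟩
  exact hQl fun b hb => (hQk a hak).trans (htile l hl a hal b hb)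

end Tessellation

/-! ### Euler inequalities for finite configurations -/

theorem extend_val_zero_of_notMem {X : Type*} {s : Set X} (g : s → ZMod 2) {x : X} (hx : x ∉ s) :
    Function.extend Subtype.val g (0 : X → ZMod 2) x = 0 :=
  Function.extend_apply' g (0 : X → ZMod 2) x fun ⟨a, ha⟩ => hx (ha ▸ a.2)

theorem Set.ncard_eq_fintype_card {X : Type*} (s : Set X) [Fintype s] :
    s.ncard = Fintype.card s := by
  rw [← Nat.card_coe_set_eq, Nat.card_eq_fintype_card]

namespace Tessellation

variable {ι : Type*} (T : Tessellation ι)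

/-- The edges between two tiles of the configuration `C`. -/
def innerEdges (C : Set ι) : Set (Set Plane) := {e | e ∈ T.edges ∧ ∀ i, e ⊆ T.tile i → i ∈ C}

/-- The edges between a tile of the configuration `C` and a tile outside of it. -/
def outerEdges (C : Set ι) : Set (Set Plane) :=
  {e | e ∈ T.edges ∧ (∃ i ∈ C, e ⊆ T.tile i) ∧ ∃ j, j ∉ C ∧ e ⊆ T.tile j}

/-- The vertices of the tiles of the configuration `C`. -/
def allVertices (C : Set ι) : Set Plane := {v | ∃ i ∈ C, v ∈ T.vertices i}

/-- The vertices at which only tiles of the configuration `C` meet. -/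
def innerVertices (C : Set ι) : Set Plane :=
  {v | 3 ≤ T.valence v ∧ ∀ i, v ∈ T.tile i → i ∈ C}

variable {T} {C : Set ι}

theorem innerVertices_subset : T.innerVertices C ⊆ T.allVertices C := by
  rintro v ⟨hv, h⟩
  obtain ⟨i, hi⟩ := T.exists_mem_tile v
  exact ⟨i, h i hi, hi, hv⟩

theorem finite_allVertices (hC : C.Finite) : (T.allVertices C).Finite := by
  apply (hC.biUnion fun i _ => T.vertices_finite i).subset
  rintro v ⟨i, hi, hv⟩
  exact Set.mem_biUnion hi hv

theorem finite_innerVertices (hC : C.Finite) : (T.innerVertices C).Finite :=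
  (finite_allVertices hC).subset innerVertices_subset

theorem finite_innerEdges (hC : C.Finite) : (T.innerEdges C).Finite := by
  apply (hC.biUnion fun i _ => T.finite_edges_of_tile i).subset
  rintro e ⟨he, h⟩
  obtain ⟨i, j, -, hk⟩ := T.exists_tiles_of_edge he
  have hi := (hk i).mpr (Or.inl rfl)
  exact Set.mem_biUnion (h i hi) ⟨he, hi⟩

theorem finite_outerEdges (hC : C.Finite) : (T.outerEdges C).Finite := by
  apply (hC.biUnion fun i _ => T.finite_edges_of_tile i).subset
  rintro e ⟨he, ⟨i, hiC, hi⟩, -⟩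
  exact Set.mem_biUnion hiC ⟨he, hi⟩

theorem mem_innerEdges_or_mem_outerEdges {e : Set Plane} (he : e ∈ T.edges) {i : ι} (hi : i ∈ C)
    (hei : e ⊆ T.tile i) : e ∈ T.innerEdges C ∨ e ∈ T.outerEdges C := by
  by_cases h : ∀ j, e ⊆ T.tile j → j ∈ C
  · exact Or.inl ⟨he, h⟩
  · push Not at h
    obtain ⟨j, hj, hjC⟩ := h
    exact Or.inr ⟨he, ⟨i, hi, hei⟩, j, hjC, hj⟩

open Classical in
/-- The number of edges of a finite configuration is at most that of its tiles and vertices. -/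
theorem ncard_innerEdges_le (hC : C.Finite) :
    (T.innerEdges C).ncard ≤ C.ncard + (T.allVertices C).ncard := by
  have := hC.fintype
  have := (finite_innerEdges (T := T) hC).fintype
  have := (finite_allVertices (T := T) hC).fintype
  let N := (incidence fun (e : T.innerEdges C) (i : C) => (e : Set Plane) ⊆ T.tile i).mulVecLin
  let M := (incidence fun (v : T.allVertices C) (e : T.innerEdges C) =>
    (v : Plane) ∈ closure (e : Set Plane)).mulVecLin
  -- A cycle of inner edges, extended by zero, still has vanishing sum at every vertex of the plane;
  -- its potential, restricted to `C`, is a preimage under `N`.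
  have hle : LinearMap.ker M ≤ LinearMap.range N := by
    intro g hg
    let G : Set Plane → ZMod 2 := Function.extend Subtype.val g 0
    have hGg : ∀ e : T.innerEdges C, G e = g e := fun e =>
      Subtype.val_injective.extend_apply g 0 e
    have hG0 : ∀ e, e ∉ T.innerEdges C → G e = 0 := fun e he =>
      extend_val_zero_of_notMem g he
    have hsum : ∀ v, 3 ≤ T.valence v → ∑ᶠ e ∈ {e | e ∈ T.edges ∧ v ∈ closure e}, G e = 0 := by
      intro v hv
      by_cases hvC : v ∈ T.allVertices C
      · have h1 : M g ⟨v, hvC⟩ = 0 := by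
          rw [LinearMap.mem_ker.mp hg]
          rfl
        change ∑ e : T.innerEdges C, (if v ∈ closure (e : Set Plane) then 1 else 0) * g e = 0 at h1
        simp_rw [← hGg] at h1
        rw [← h1, ← finsum_eq_sum_of_fintype, finsum_set_coe_eq_finsum_mem
          (f := fun e => (if v ∈ closure e then 1 else 0) * G e), finsum_mem_def, finsum_mem_def]
        congr 1
        funext e
        by_cases he : e ∈ T.innerEdges C
        · rw [Set.indicator_of_mem he]
          by_cases hve : v ∈ closure e
          · rw [if_pos hve, one_mul, Set.indicator_of_mem]
            exact ⟨he.1, hve⟩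
          · rw [if_neg hve, zero_mul, Set.indicator_of_notMem]
            exact fun h => hve h.2
        · rw [Set.indicator_of_notMem he, Set.indicator_apply, hG0 e he, ite_self]
      · apply finsum_mem_eq_zero_of_forall_eq_zero
        rintro e ⟨he, hve⟩
        apply hG0
        rintro ⟨-, h⟩
        obtain ⟨i, j, -, hk⟩ := T.exists_tiles_of_edge he
        have hi := (hk i).mpr (Or.inl rfl)
        exact hvC ⟨i, h i hi, T.closure_edge_subset hi hve, hv⟩
    obtain ⟨f, hf⟩ := T.exists_potential G hsum
    refine ⟨fun i => f i, ?_⟩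
    funext e
    obtain ⟨i, j, hij, hk⟩ := T.exists_tiles_of_edge e.2.1
    have hi := (hk i).mpr (Or.inl rfl)
    have hj := (hk j).mpr (Or.inr rfl)
    rw [← hGg, ← hf e e.2.1 i j hij hi hj, ZMod.two_sub_eq_add]
    exact sum_subtype_ite_mul C (fun k => (e : Set Plane) ⊆ T.tile k) f hij (fun k _ => hk k)
      (fun h => absurd (e.2.2 i hi) h) (fun h => absurd (e.2.2 j hj) h)
  -- With `E`, `V` and `F` counting inner edges, all vertices and tiles, `E - V ≤ dim ker M ≤ rank N
  -- ≤ F`.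
  have h1 := LinearMap.finrank_range_add_finrank_ker M
  have h2 := LinearMap.finrank_range_add_finrank_ker N
  have h3 := Submodule.finrank_mono hle
  have h4 := Submodule.finrank_le (LinearMap.range M)
  rw [Module.finrank_fintype_fun_eq_card] at h1 h2 h4
  rw [Set.ncard_eq_fintype_card C, Set.ncard_eq_fintype_card (T.innerEdges C),
    Set.ncard_eq_fintype_card (T.allVertices C)]
  omega

open Classical in
/-- A function on the tiles of a finite configuration that is constant across its inner edges is
determined by its values along the outer edges. -/
theorem finrank_ker_innerEdges_le (hC : C.Finite) [Fintype C] [Fintype (T.outerEdges C)]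
    [Fintype (T.innerEdges C)] :
    Module.finrank (ZMod 2) (LinearMap.ker
      (incidence fun (e : T.innerEdges C) (i : C) => (e : Set Plane) ⊆ T.tile i).mulVecLin) ≤
      Fintype.card (T.outerEdges C) := by
  set N := (incidence fun (e : T.innerEdges C) (i : C) => (e : Set Plane) ⊆ T.tile i).mulVecLin
  choose c hcC hc using fun e : T.outerEdges C => e.2.2.1
  let ρ : (C → ZMod 2) →ₗ[ZMod 2] (T.outerEdges C → ZMod 2) :=
    LinearMap.funLeft (ZMod 2) (ZMod 2) fun e => ⟨c e, hcC e⟩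
  have hinj : Function.Injective (ρ.comp (LinearMap.ker N).subtype) := by
    rw [← LinearMap.ker_eq_bot, LinearMap.ker_eq_bot']
    rintro ⟨f, hf⟩ h0
    have hout : ∀ e : T.outerEdges C, f ⟨c e, hcC e⟩ = 0 := fun e => congrFun h0 e
    let F : ι → ZMod 2 := Function.extend Subtype.val f 0
    have hFf : ∀ i : C, F i = f i := fun i => Subtype.val_injective.extend_apply f 0 i
    have hF0 : ∀ i, i ∉ C → F i = 0 := fun i hi =>
      extend_val_zero_of_notMem f hi
    -- Extended by zero, `f` is constant across all edges: inner ones by the kernel condition, outer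
    -- ones because both sides vanish. Hence it is constant on the tessellation, and some tile lies
    -- outside `C`.
    have hconst : ∀ e ∈ T.edges, ∀ i j, e ⊆ T.tile i → e ⊆ T.tile j → F i = F j := by
      intro e he i j hi hj
      rcases eq_or_ne i j with rfl | hij
      · rfl
      have hk : ∀ k, e ⊆ T.tile k ↔ k = i ∨ k = j := by
        obtain ⟨a, b, hab, hk⟩ := T.exists_tiles_of_edge he
        intro k
        rw [hk] at hi hj ⊢
        rcases hi with rfl | rfl <;> rcases hj with rfl | rfl
        · exact absurd rfl hij
        · rfl
        · exact or_comm
        · exact absurd rfl hij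
      by_cases hin : e ∈ T.innerEdges C
      · have h1 : N f ⟨e, hin⟩ = 0 := by
          rw [LinearMap.mem_ker.mp hf]
          rfl
        change ∑ k : C, (if e ⊆ T.tile k then 1 else 0) * f k = 0 at h1
        simp_rw [← hFf] at h1
        rw [sum_subtype_ite_mul C (fun k => e ⊆ T.tile k) F hij (fun k _ => hk k)
          (hF0 i) (hF0 j)] at h1
        exact ZMod.two_add_eq_zero_iff.mp h1
      · have h2 : ∀ k, e ⊆ T.tile k → F k = 0 := by
          intro k hek
          by_cases hkC : k ∈ C
          · have hout' : e ∈ T.outerEdges C :=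
              (mem_innerEdges_or_mem_outerEdges he hkC hek).resolve_left hin
            obtain ⟨l, hlC, hel⟩ := hout'.2.2
            have h3 := hc ⟨e, hout'⟩
            have h4 : c ⟨e, hout'⟩ = k := by
              have h5 : l ≠ c ⟨e, hout'⟩ := fun h => hlC (h ▸ hcC _)
              have h6 : l ≠ k := fun h => hlC (h ▸ hkC)
              rw [hk] at h3 hel hek
              grind
            have h5 := hout ⟨e, hout'⟩
            rw [← hFf] at h5
            rw [← h4]
            exact h5
          · exact hF0 k hkC
        rw [h2 i hi, h2 j hj]
    obtain ⟨p, hp⟩ := T.exists_notMem_of_finite hC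
    obtain ⟨j, hj⟩ := T.exists_mem_tile p
    apply Subtype.ext
    funext i
    change f i = 0
    rw [← hFf, T.eq_of_forall_edge F hconst i j]
    exact hF0 j fun h => hp j h hj
  have := LinearMap.finrank_le_finrank_of_injective hinj
  rwa [Module.finrank_fintype_fun_eq_card] at this

open Classical in
/-- A function on the inner vertices of the configuration of a disk that is constant along the
inner edges, and vanishes at the outer ends of these edges, is constant. -/
theorem finrank_ker_innerVertices_le {x : Plane} {r : ℝ} (hCx : C = T.configuration x r)
    [Fintype (T.innerEdges C)] [Fintype (T.innerVertices C)] :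
    Module.finrank (ZMod 2) (LinearMap.ker
      (incidence fun (e : T.innerEdges C) (v : T.innerVertices C) =>
        (v : Plane) ∈ closure (e : Set Plane)).mulVecLin) ≤ 1 := by
  set M := (incidence fun (e : T.innerEdges C) (v : T.innerVertices C) =>
    (v : Plane) ∈ closure (e : Set Plane)).mulVecLin
  rcases isEmpty_or_nonempty (T.innerVertices C) with hE | ⟨⟨v₀⟩⟩
  · have h1 := Submodule.finrank_le (LinearMap.ker M)
    rw [Module.finrank_fintype_fun_eq_card, Fintype.card_eq_zero] at h1
    omega
  have hinj : Function.Injective ((LinearMap.proj (R := ZMod 2)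
      (φ := fun _ : T.innerVertices C => ZMod 2) v₀).comp (LinearMap.ker M).subtype) := by
    rw [← LinearMap.ker_eq_bot, LinearMap.ker_eq_bot']
    rintro ⟨φ, hφ⟩ h0
    have h0' : φ v₀ = 0 := h0
    let F : Plane → ZMod 2 := Function.extend Subtype.val φ 0
    have hFf : ∀ v : T.innerVertices C, F v = φ v := fun v =>
      Subtype.val_injective.extend_apply φ 0 v
    have hF0 : ∀ v, v ∉ T.innerVertices C → F v = 0 := fun v hv =>
      extend_val_zero_of_notMem φ hv
    have hconst : ∀ e ∈ T.edges, ∀ i ∈ C, e ⊆ T.tile i → ∀ a ∈ closure e,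
        ∀ b ∈ closure e, 3 ≤ T.valence a → 3 ≤ T.valence b → F a = F b := by
      intro e he i hiC hei a ha b hb ha3 hb3
      rcases mem_innerEdges_or_mem_outerEdges he hiC hei with hin | hout
      · obtain ⟨a', b', hab, hk⟩ := T.exists_ends_of_edge he
        have h1 : M φ ⟨e, hin⟩ = 0 := by
          rw [LinearMap.mem_ker.mp hφ]
          rfl
        change ∑ v : T.innerVertices C, (if (v : Plane) ∈ closure e then 1 else 0) * φ v = 0 at h1
        simp_rw [← hFf] at h1
        rw [sum_subtype_ite_mul (T.innerVertices C) (fun v => v ∈ closure e) F hab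
          (fun v hv => by rw [← hk v]; exact ⟨fun h => ⟨hv.1, h⟩, fun h => h.2⟩)
          (hF0 a') (hF0 b')] at h1
        have h2 := ZMod.two_add_eq_zero_iff.mp h1
        rcases (hk a).mp ⟨ha3, ha⟩ with rfl | rfl <;> rcases (hk b).mp ⟨hb3, hb⟩ with rfl | rfl
        · rfl
        · exact h2
        · exact h2.symm
        · rfl
      · obtain ⟨j, hjC, hj⟩ := hout.2.2
        have h2 : ∀ u ∈ closure e, F u = 0 := fun u hu =>
          hF0 u fun h => hjC (h.2 j (T.closure_edge_subset hj hu))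
        rw [h2 a ha, h2 b hb]
    apply Subtype.ext
    funext v
    change φ v = 0
    obtain ⟨i, hi, hvi⟩ := innerVertices_subset v.2
    obtain ⟨j, hj, hvj⟩ := innerVertices_subset v₀.2
    rw [← h0', ← hFf, ← hFf]
    -- The disk enters here: its connectedness links the vertices of the tiles that meet it.
    exact T.eq_of_forall_edge_of_configuration F x r (hCx ▸ hconst) (hCx ▸ hi) (hCx ▸ hj) hvi hvj
  have := LinearMap.finrank_le_finrank_of_injective hinj
  rwa [Module.finrank_self] at this

-- Since `B.transpose * A = 0`, the ranks of `A` and `B` add up to at most the number of inner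
-- edges. The kernel of `A` has at most the number of outer edges as dimension, and that of `B` at
-- most one.
open Classical in
theorem ncard_add_ncard_innerVertices_le {x : Plane} {r : ℝ} (hCx : C = T.configuration x r) :
    C.ncard + (T.innerVertices C).ncard ≤
      (T.innerEdges C).ncard + (T.outerEdges C).ncard + 1 := by
  have hC : C.Finite := hCx ▸ T.configuration_finite x r
  have := hC.fintype
  have := (finite_innerEdges (T := T) hC).fintype
  have := (finite_outerEdges (T := T) hC).fintype
  have := (finite_innerVertices (T := T) hC).fintype
  let A := incidence fun (e : T.innerEdges C) (i : C) => (e : Set Plane) ⊆ T.tile i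
  let B := incidence fun (e : T.innerEdges C) (v : T.innerVertices C) =>
    (v : Plane) ∈ closure (e : Set Plane)
  -- The entry at `(v, i)` counts the edges of tile `i` ending at the inner vertex `v`: two or none.
  -- Innerness of `v` makes these edges inner, so none is lost.
  have hzero : B.transpose * A = 0 := by
    ext v i
    rw [Matrix.mul_apply, Matrix.zero_apply]
    change ∑ e : T.innerEdges C, (if (v : Plane) ∈ closure (e : Set Plane) then 1 else 0) *
      (if (e : Set Plane) ⊆ T.tile i then 1 else 0) = 0
    by_cases hv : (v : Plane) ∈ T.tile i
    · obtain ⟨a, b, hab, hf⟩ := T.exists_edges_of_vertex (i := i) (v := v) ⟨hv, v.2.1⟩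
      have ha := (hf a).mpr (Or.inl rfl)
      have hb := (hf b).mpr (Or.inr rfl)
      have hin : ∀ e ∈ T.edges, (v : Plane) ∈ closure e → e ∈ T.innerEdges C :=
        fun e he hve => ⟨he, fun j hj => v.2.2 j (T.closure_edge_subset hj hve)⟩
      have key := sum_subtype_ite_mul (T.innerEdges C)
        (fun e => (v : Plane) ∈ closure e ∧ e ⊆ T.tile i) (fun _ => 1) hab
        (fun e he => by rw [← hf e]; exact ⟨fun h => ⟨he.1, h.2, h.1⟩, fun h => ⟨h.2.2, h.2.1⟩⟩)
        (fun h => absurd (hin a ha.1 ha.2.2) h) (fun h => absurd (hin b hb.1 hb.2.2) h)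
      refine Eq.trans (Finset.sum_congr rfl ?_) (key.trans (ZMod.two_add_eq_zero_iff.mpr rfl))
      intro e _
      rw [mul_one, ite_and, ite_mul, one_mul, zero_mul]
    · apply Finset.sum_eq_zero
      intro e _
      by_cases hve : (v : Plane) ∈ closure (e : Set Plane)
      · rw [if_neg (fun h : (e : Set Plane) ⊆ T.tile i => hv (T.closure_edge_subset h hve)),
          mul_zero]
      · rw [if_neg hve, zero_mul]
  have hle : LinearMap.range A.mulVecLin ≤ LinearMap.ker B.transpose.mulVecLin := by
    rintro _ ⟨f, rfl⟩
    rw [LinearMap.mem_ker, Matrix.mulVecLin_apply, Matrix.mulVecLin_apply, Matrix.mulVec_mulVec,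
      hzero, Matrix.zero_mulVec]
  have h1 := LinearMap.finrank_range_add_finrank_ker A.mulVecLin
  have h2 := LinearMap.finrank_range_add_finrank_ker B.mulVecLin
  have h3 := LinearMap.finrank_range_add_finrank_ker B.transpose.mulVecLin
  have h4 := Submodule.finrank_mono hle
  have h5 : Module.finrank (ZMod 2) (LinearMap.range B.transpose.mulVecLin) =
      Module.finrank (ZMod 2) (LinearMap.range B.mulVecLin) := Matrix.rank_transpose B
  have h6 : Module.finrank (ZMod 2) (LinearMap.ker A.mulVecLin) ≤ _ :=
    finrank_ker_innerEdges_le hC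
  have h7 : Module.finrank (ZMod 2) (LinearMap.ker B.mulVecLin) ≤ 1 :=
    finrank_ker_innerVertices_le hCx
  rw [Module.finrank_fintype_fun_eq_card] at h1 h2 h3
  rw [Set.ncard_eq_fintype_card C, Set.ncard_eq_fintype_card (T.innerEdges C),
    Set.ncard_eq_fintype_card (T.outerEdges C), Set.ncard_eq_fintype_card (T.innerVertices C)]
  omega

end Tessellation

/-! ### Double counting and the bound on the total imbalance -/

/-- The open unit disk is dense in the closed unit disk. -/
theorem exists_mem_norm_lt_one {U : Set ClosedDisk} (hU : IsOpen U) {x : ClosedDisk}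
    (hx : x ∈ U) : ∃ y ∈ U, ‖(y : Plane)‖ < 1 := by
  obtain ⟨V, hV, rfl⟩ := isOpen_induced_iff.mp hU
  have h1 : (x : Plane) ∈ closure (Metric.ball (0 : Plane) 1) := by
    rw [closure_ball _ one_ne_zero]
    exact x.2
  obtain ⟨y, hyV, hy⟩ := mem_closure_iff.mp h1 V hV hx
  have hy' := mem_ball_zero_iff.mp hy
  exact ⟨⟨y, mem_closedBall_zero_iff.mpr hy'.le⟩, hyV, hy'⟩

namespace Tessellation

variable {ι : Type*} (T : Tessellation ι)

/-- Count incident pairs: each vertex of the tile ends two of its edges, and each edge has two ends.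
-/
theorem ncard_vertices_eq (i : ι) :
    (T.vertices i).ncard = {e | e ∈ T.edges ∧ e ⊆ T.tile i}.ncard := by
  classical
  have hV := T.vertices_finite i
  have hE := T.finite_edges_of_tile i
  rw [Set.ncard_eq_toFinset_card _ hV, Set.ncard_eq_toFinset_card _ hE]
  have h1 := Finset.sum_card_bipartiteAbove_eq_sum_card_bipartiteBelow
    (fun (v : Plane) (e : Set Plane) => v ∈ closure e) (s := hV.toFinset) (t := hE.toFinset)
  have h2 : ∀ v ∈ hV.toFinset, (Finset.bipartiteAbove (fun (v : Plane) (e : Set Plane) =>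
      v ∈ closure e) hE.toFinset v).card = 2 := by
    intro v hv
    obtain ⟨a, b, hab, h⟩ := T.exists_edges_of_vertex (hV.mem_toFinset.mp hv)
    refine Eq.trans (congrArg Finset.card ?_) (Finset.card_pair hab)
    ext e
    simp only [Finset.bipartiteAbove, Finset.mem_filter, Set.Finite.mem_toFinset,
      Finset.mem_insert, Finset.mem_singleton, ← h, Set.mem_ofPred_eq]
    tauto
  have h3 : ∀ e ∈ hE.toFinset, (Finset.bipartiteBelow (fun (v : Plane) (e : Set Plane) =>
      v ∈ closure e) hV.toFinset e).card = 2 := by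
    intro e he
    have he' := hE.mem_toFinset.mp he
    obtain ⟨a, b, hab, h⟩ := T.exists_ends_of_edge he'.1
    refine Eq.trans (congrArg Finset.card ?_) (Finset.card_pair hab)
    ext v
    simp only [Finset.bipartiteBelow, Finset.mem_filter, Set.Finite.mem_toFinset,
      Finset.mem_insert, Finset.mem_singleton, ← h, T.mem_vertices]
    have := T.closure_edge_subset he'.2 (a := v)
    tauto
  rw [Finset.sum_congr rfl h2, Finset.sum_congr rfl h3] at h1
  simpa using h1

variable {T} {C : Set ι}

/-- Replace vertices by edges of each tile; an inner edge is then counted from both sides, an outer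
edge from one. -/
theorem sum_ncard_vertices (hC : C.Finite) :
    ∑ i ∈ hC.toFinset, (T.vertices i).ncard =
      2 * (T.innerEdges C).ncard + (T.outerEdges C).ncard := by
  classical
  have hI := finite_innerEdges (T := T) hC
  have hO := finite_outerEdges (T := T) hC
  have hdisj : Disjoint hI.toFinset hO.toFinset := by
    rw [Finset.disjoint_left]
    intro e he he'
    obtain ⟨j, hj, hej⟩ := (hO.mem_toFinset.mp he').2.2
    exact hj ((hI.mem_toFinset.mp he).2 j hej)
  have h1 := Finset.sum_card_bipartiteAbove_eq_sum_card_bipartiteBelow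
    (fun (i : ι) (e : Set Plane) => e ⊆ T.tile i) (s := hC.toFinset)
    (t := hI.toFinset ∪ hO.toFinset)
  have h2 : ∀ i ∈ hC.toFinset, (Finset.bipartiteAbove (fun (i : ι) (e : Set Plane) =>
      e ⊆ T.tile i) (hI.toFinset ∪ hO.toFinset) i).card = (T.vertices i).ncard := by
    intro i hi
    rw [T.ncard_vertices_eq, Set.ncard_eq_toFinset_card _ (T.finite_edges_of_tile i)]
    congr 1
    ext e
    simp only [Finset.bipartiteAbove, Finset.mem_filter, Finset.mem_union,
      Set.Finite.mem_toFinset, Set.mem_ofPred_eq]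
    constructor
    · rintro ⟨h | h, hei⟩
      · exact ⟨h.1, hei⟩
      · exact ⟨h.1, hei⟩
    · rintro ⟨he, hei⟩
      exact ⟨mem_innerEdges_or_mem_outerEdges he (hC.mem_toFinset.mp hi) hei, hei⟩
  have h3 : ∀ e ∈ hI.toFinset, (Finset.bipartiteBelow (fun (i : ι) (e : Set Plane) =>
      e ⊆ T.tile i) hC.toFinset e).card = 2 := by
    intro e he
    have he' := hI.mem_toFinset.mp he
    obtain ⟨a, b, hab, h⟩ := T.exists_tiles_of_edge he'.1
    refine Eq.trans (congrArg Finset.card ?_) (Finset.card_pair hab)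
    ext k
    simp only [Finset.bipartiteBelow, Finset.mem_filter, Set.Finite.mem_toFinset,
      Finset.mem_insert, Finset.mem_singleton, ← h]
    exact ⟨fun hk => hk.2, fun hk => ⟨he'.2 k hk, hk⟩⟩
  have h4 : ∀ e ∈ hO.toFinset, (Finset.bipartiteBelow (fun (i : ι) (e : Set Plane) =>
      e ⊆ T.tile i) hC.toFinset e).card = 1 := by
    intro e he
    obtain ⟨hee, ⟨i, hi, hei⟩, j, hj, hej⟩ := hO.mem_toFinset.mp he
    obtain ⟨a, b, hab, h⟩ := T.exists_tiles_of_edge hee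
    rw [Finset.card_eq_one]
    refine ⟨i, ?_⟩
    ext k
    simp only [Finset.bipartiteBelow, Finset.mem_filter, Set.Finite.mem_toFinset,
      Finset.mem_singleton]
    constructor
    · rintro ⟨hk, hek⟩
      have hkj : k ≠ j := fun h => hj (h ▸ hk)
      have hij : i ≠ j := fun h => hj (h ▸ hi)
      rw [h] at hei hej hek
      grind
    · rintro rfl
      exact ⟨hi, hei⟩
  rw [Finset.sum_congr rfl h2, Finset.sum_union hdisj, Finset.sum_congr rfl h3,
    Finset.sum_congr rfl h4] at h1
  rw [h1, Set.ncard_eq_toFinset_card _ hI, Set.ncard_eq_toFinset_card _ hO]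
  simp [mul_comm]

/-- Every vertex of a configuration that is not an inner vertex is the end of an outer edge. -/
theorem exists_outerEdge_of_notMem_innerVertices {v : Plane} (hv : v ∈ T.allVertices C)
    (hv' : v ∉ T.innerVertices C) : ∃ e ∈ T.outerEdges C, v ∈ closure e := by
  obtain ⟨i, hi, hvi⟩ := hv
  by_contra! h
  refine hv' ⟨hvi.2, fun j hj => ?_⟩
  -- Without an outer edge ending at `v`, membership in `C` would spread to every tile at `v`.
  refine (T.iff_of_forall_edge v (fun k => k ∈ C) ?_ hvi.1 hj).mp hi
  intro e he hve a b ha hb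
  constructor
  · intro haC
    by_contra hbC
    exact h e ⟨he, ⟨a, haC, ha⟩, b, hbC, hb⟩ hve
  · intro hbC
    by_contra haC
    exact h e ⟨he, ⟨b, hbC, hb⟩, a, haC, ha⟩ hve

theorem ncard_allVertices_le (hC : C.Finite) :
    (T.allVertices C).ncard ≤ (T.innerVertices C).ncard + 2 * (T.outerEdges C).ncard := by
  classical
  have hO := finite_outerEdges (T := T) hC
  choose! a b hab h using fun e (he : e ∈ T.outerEdges C) => T.exists_ends_of_edge he.1
  have hsub : T.allVertices C ⊆ T.innerVertices C ∪
      (hO.toFinset.biUnion fun e => {a e, b e} : Finset Plane) := by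
    intro v hv
    by_cases hv' : v ∈ T.innerVertices C
    · exact Or.inl hv'
    · right
      obtain ⟨e, he, hve⟩ := exists_outerEdge_of_notMem_innerVertices hv hv'
      obtain ⟨i, -, hvi⟩ := hv
      rw [Finset.mem_coe, Finset.mem_biUnion]
      refine ⟨e, hO.mem_toFinset.mpr he, ?_⟩
      rw [Finset.mem_insert, Finset.mem_singleton, ← h e he]
      exact ⟨hvi.2, hve⟩
  have h1 := Set.ncard_le_ncard hsub
    ((finite_innerVertices hC).union (Finset.finite_toSet _))
  have h2 := Set.ncard_union_le (T.innerVertices C)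
    (hO.toFinset.biUnion fun e => {a e, b e} : Finset Plane)
  have h3 := Finset.card_biUnion_le_card_mul hO.toFinset (fun e => ({a e, b e} : Finset Plane)) 2
    fun e _ => Finset.card_le_two
  rw [Set.ncard_coe_finset] at h2
  rw [Set.ncard_eq_toFinset_card _ hO]
  omega

/-- After exchanging the sums, a vertex contributes `2π` times the fraction of its tiles that lie in
`C`; this fraction is one at inner vertices. -/
theorem sum_angles_bounds (hC : C.Finite) :
    2 * Real.pi * (T.innerVertices C).ncard ≤
        ∑ i ∈ hC.toFinset, ∑ᶠ p ∈ T.vertices i, 2 * Real.pi / (T.valence p : ℝ) ∧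
      ∑ i ∈ hC.toFinset, ∑ᶠ p ∈ T.vertices i, 2 * Real.pi / (T.valence p : ℝ) ≤
        2 * Real.pi * (T.allVertices C).ncard := by
  classical
  have hV := finite_allVertices (T := T) hC
  have hVi := finite_innerVertices (T := T) hC
  have hpi := Real.pi_pos
  have h1 : ∑ i ∈ hC.toFinset, ∑ᶠ p ∈ T.vertices i, 2 * Real.pi / (T.valence p : ℝ) =
      ∑ p ∈ hV.toFinset, ((hC.toFinset.filter fun i => p ∈ T.tile i).card : ℝ) *
        (2 * Real.pi / (T.valence p : ℝ)) := by
    simp_rw [fun i => finsum_mem_eq_finite_toFinset_sum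
      (fun p => 2 * Real.pi / (T.valence p : ℝ)) (T.vertices_finite i)]
    rw [Finset.sum_comm' (t' := hV.toFinset)
      (s' := fun p => hC.toFinset.filter fun i => p ∈ T.tile i)]
    · simp
    · intro i p
      simp only [Set.Finite.mem_toFinset, Finset.mem_filter, T.mem_vertices]
      constructor
      · rintro ⟨hi, hp, h3⟩
        exact ⟨⟨hi, hp⟩, i, hi, hp, h3⟩
      · rintro ⟨⟨hi, hp⟩, j, -, -, h3⟩
        exact ⟨hi, hp, h3⟩
  have hle : ∀ p, (hC.toFinset.filter fun i => p ∈ T.tile i).card ≤ T.valence p := by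
    intro p
    rw [valence_eq, Set.ncard_eq_toFinset_card _ (T.finite_tilesAt p)]
    apply Finset.card_le_card
    intro i hi
    rw [Set.Finite.mem_toFinset]
    exact (Finset.mem_filter.mp hi).2
  have heq : ∀ p ∈ T.innerVertices C,
      (hC.toFinset.filter fun i => p ∈ T.tile i).card = T.valence p := by
    intro p hp
    apply le_antisymm (hle p)
    rw [valence_eq, Set.ncard_eq_toFinset_card _ (T.finite_tilesAt p)]
    apply Finset.card_le_card
    intro i hi
    rw [Set.Finite.mem_toFinset] at hi
    exact Finset.mem_filter.mpr ⟨hC.mem_toFinset.mpr (hp.2 i hi), hi⟩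
  have hval : ∀ p, (0 : ℝ) < T.valence p := fun p => by exact_mod_cast T.valence_pos p
  rw [h1]
  constructor
  · have hsub : hVi.toFinset ⊆ hV.toFinset := by
      rw [Set.Finite.toFinset_subset_toFinset]
      exact innerVertices_subset
    refine le_trans (le_of_eq ?_) (Finset.sum_le_sum_of_subset_of_nonneg hsub fun p _ _ => ?_)
    · rw [Finset.sum_congr rfl fun p hp => ?_, Finset.sum_const,
        Set.ncard_eq_toFinset_card _ hVi, nsmul_eq_mul, mul_comm]
      rw [heq p (hVi.mem_toFinset.mp hp)]
      exact mul_div_cancel₀ _ (hval p).ne'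
    · have := hval p
      positivity
  · rw [Set.ncard_eq_toFinset_card _ hV, mul_comm (2 * Real.pi), ← nsmul_eq_mul]
    apply Finset.sum_le_card_nsmul
    intro p _
    rw [mul_div_assoc', div_le_iff₀ (hval p), mul_comm]
    gcongr
    exact hle p

/-- This connects the combinatorial boundary with the topological one in the hypothesis. Near a
point of the edge, the tile outside `C` has points with parameter in the open disk, and these lie in
no other tile. -/
theorem outerEdges_subset_boundaryEdges (hC : C.Finite) :
    T.outerEdges C ⊆ T.boundaryEdges C := by
  rintro e ⟨he, ⟨i, hi, hei⟩, j, hj, hej⟩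
  refine ⟨he, fun q hq => ?_⟩
  have hclosed : IsClosed (⋃ k ∈ C, T.tile k) := hC.isClosed_biUnion fun k _ => T.isClosed_tile k
  rw [hclosed.frontier_eq]
  refine ⟨Set.mem_biUnion hi (hei hq), fun hint => ?_⟩
  obtain ⟨x, rfl⟩ := hej hq
  obtain ⟨y, hy, hnorm⟩ := exists_mem_norm_lt_one
    (isOpen_interior.preimage (T.continuous_param j)) (x := x) hint
  obtain ⟨k, hk, hkm⟩ := Set.mem_iUnion₂.mp (interior_subset hy)
  have hjk : j ≠ k := fun h => hj (h ▸ hk)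
  exact hnorm.ne (T.no_overlap j k hjk _ hkm)

/-- The total imbalance of the configuration of a disk is bounded by its number of boundary
edges. -/
theorem abs_sum_imbalance_le (x : Plane) (r : ℝ)
    (hfin : (T.boundaryEdges (T.configuration x r)).Finite) :
    |∑ᶠ i ∈ T.configuration x r, T.imbalance i| ≤
      5 * Real.pi * (T.boundaryEdges (T.configuration x r)).ncard + 2 * Real.pi := by
  have hC := T.configuration_finite x r
  have hEuler := ncard_add_ncard_innerVertices_le (T := T) (x := x) (r := r) rfl
  generalize hCx : T.configuration x r = C at *
  have hB := Set.ncard_le_ncard (outerEdges_subset_boundaryEdges (T := T) hC) hfin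
  have h1 := ncard_innerEdges_le (T := T) hC
  have h2 := ncard_allVertices_le (T := T) hC
  obtain ⟨h3, h4⟩ := sum_angles_bounds (T := T) hC
  have h5 : (∑ i ∈ hC.toFinset, ((T.vertices i).ncard : ℝ)) =
      2 * (T.innerEdges C).ncard + (T.outerEdges C).ncard := by
    exact_mod_cast sum_ncard_vertices (T := T) hC
  have h6 : ∑ᶠ i ∈ C, T.imbalance i =
      ∑ i ∈ hC.toFinset, (∑ᶠ p ∈ T.vertices i, 2 * Real.pi / (T.valence p : ℝ)) -
        (2 * (T.innerEdges C).ncard + (T.outerEdges C).ncard) * Real.pi +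
        2 * Real.pi * C.ncard := by
    rw [finsum_mem_eq_finite_toFinset_sum _ hC, ← h5, Set.ncard_eq_toFinset_card _ hC]
    simp only [imbalance, Finset.sum_sub_distrib, ← Finset.sum_mul, Finset.sum_const,
      nsmul_eq_mul]
    ring
  have hpi := Real.pi_pos
  have hEuler' : (C.ncard : ℝ) + (T.innerVertices C).ncard ≤
      (T.innerEdges C).ncard + (T.outerEdges C).ncard + 1 := by exact_mod_cast hEuler
  have hB' : ((T.outerEdges C).ncard : ℝ) ≤ (T.boundaryEdges C).ncard := by exact_mod_cast hB
  have h1' : ((T.innerEdges C).ncard : ℝ) ≤ C.ncard + (T.allVertices C).ncard := by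
    exact_mod_cast h1
  have h2' : ((T.allVertices C).ncard : ℝ) ≤
      (T.innerVertices C).ncard + 2 * (T.outerEdges C).ncard := by exact_mod_cast h2
  have m1 := mul_le_mul_of_nonneg_left hEuler' hpi.le
  have m2 := mul_le_mul_of_nonneg_left hB' hpi.le
  have m3 := mul_le_mul_of_nonneg_left h1' hpi.le
  have m4 := mul_le_mul_of_nonneg_left h2' hpi.le
  -- With `b` outer edges, the upper bound combines the vertex estimate (`4πb`) and the lower edge
  -- bound (`2πb + 2π`) with the term `-πb`; the lower bound needs the vertex estimate and the upper
  -- edge bound, and costs `5πb`.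
  rw [h6, abs_le]
  constructor <;> linarith

end Tessellation

/-! ### The limit -/

theorem mainTheorem1 {ι : Type*} (T : Tessellation ι) (hT : T.ReasonablyRound) :
    TendstoUniformly (fun (r : ℝ) (x : Plane) => T.averageImbalance x r) (fun _ => 0)
      Filter.atTop := by
  obtain ⟨c₁, c₂, R₀, hc₁, hround⟩ := hT
  rw [Metric.tendstoUniformly_iff]
  intro ε hε
  -- This is the final quotient `(5π c₂ r + 2π) / (c₁ r ^ 2)`, in which the center does not occur.
  have hlim : Filter.Tendsto (fun r : ℝ => (5 * Real.pi * c₂ / c₁) * r⁻¹ +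
      (2 * Real.pi / c₁) * (r⁻¹ * r⁻¹)) Filter.atTop (𝓝 0) := by
    have h := tendsto_inv_atTop_zero (𝕜 := ℝ)
    simpa using (h.const_mul (5 * Real.pi * c₂ / c₁)).add ((h.mul h).const_mul (2 * Real.pi / c₁))
  filter_upwards [hlim.eventually (gt_mem_nhds hε), Filter.eventually_ge_atTop R₀,
    Filter.eventually_gt_atTop 0] with r hr hrR hr0 x
  obtain ⟨htiles, hfin, hedges⟩ := hround r hrR x
  have hb := Tessellation.abs_sum_imbalance_le x r hfin
  have hpos : 0 < c₁ * r ^ 2 := by positivity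
  have hN := hpos.trans_le htiles
  rw [dist_zero_left, Real.norm_eq_abs, Tessellation.averageImbalance, abs_div, abs_of_pos hN]
  refine lt_of_le_of_lt ?_ hr
  have hnum : |∑ᶠ i ∈ T.configuration x r, T.imbalance i| ≤
      5 * Real.pi * (c₂ * r) + 2 * Real.pi := by
    refine hb.trans ?_
    have := Real.pi_pos
    gcongr
  calc |∑ᶠ i ∈ T.configuration x r, T.imbalance i| / ((T.configuration x r).ncard : ℝ)
      ≤ (5 * Real.pi * (c₂ * r) + 2 * Real.pi) / (c₁ * r ^ 2) :=
        div_le_div₀ ((abs_nonneg _).trans hnum) hnum hpos htiles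
    _ = _ := by field_simp
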